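/- Let $\Delta$ be a (possibly infinite) abstract simplicial complex, let its vertices be totally ordered, and let $R$ be a commutative ring with identity. Let $\mathcal{P}(\Delta)$ be the poset of non-empty simplices ordered by inclusion and graded by $\dim\sigma=|\sigma|-1$, with the empty simplex added as $\hat 0$ in $\hat{\mathcal{P}}(\Delta)$, $\dim\hat 0=-1$. For $\sigma\in\mathcal{P}(\Delta)$ put $\sigma^*=\min\sigma$, $\mathcal{K}_\sigma=\{\tau\subseteq\sigma : \sigma^*\notin\tau\}$ and $\eta_\sigma(\tau)=\tau\cup\{\sigma^*\}$ for $\tau\in\mathcal{K}_\sigma$. Then $\mathcal{K}_\Delta=\{\mathcal{K}_\sigma,\eta_\sigma\}_\sigma$ is a local covering family for $\mathcal{P}(\Delta)$. Here a local covering family for a graded poset $\mathcal{P}$ consists of subposets $\mathcal{K}_p\subseteq\hat{\mathcal{P}}_{\le p}$ and maps $\eta_p:\mathcal{K}_p\to\hat{\mathcal{P}}_{\le p}\setminus\mathcal{K}_p$ ($p\in\mathcal{P}$) such that $\hat 0\in\mathcal{K}_p$; $q<\eta_p(q)$ and $\dim\eta_p(q)=\dim q+1$ for $q\in\mathcal{K}_p$;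 $\eta_p(\hat 0)=\eta_q(\hat 0)$ if $q\le p$ and $q\notin\mathcal{K}_p$; $\eta_p(q)\le\eta_p(r)$ if $q\le r$ lie in $\mathcal{K}_p$; and $\eta_p(q)\le r$ if $q\in\mathcal{K}_p$, $r\notin\mathcal{K}_p$ and $q\le r\le p$. Let $C_*$ be the augmented simplicial chain complex over $R$ of the order complex of $\mathcal{P}$ (with $C_{-1}=R$) and let $F_iC_*$ be spanned by the chains $p_0<\dots<p_j$ with $\dim p_j\le i$ (and by $C_{-1}$, if $i\ge -1$). For $n\ge 0$ the module $H_n(F_nC_*/F_{n-1}C_*)\cong\bigoplus_{\dim p=n}\widetilde H_{n-1}(|\mathcal{P}_{<p}|;R)$ is free; it has a basis indexed by the chains $p_0<\dots<p_n$ with $\dim p_i=i$ and $p_i\in\mathcal{K}_{p_{i+1}}$, in which the coordinate of $[z]$ at such a chain is $(-1)^{n(n+1)/2}$ times the coefficient of that chain in $z$. The chain complex $C^{\mathcal{K}}_*(\mathcal{P};R)$ has these modules, in degrees $n\ge 0$, written in these bases as $C^{\mathcal{K}}_n=\bigoplus_{\dim p=n}R^{K^p_n}$ (where $K^p_0=1$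 and $K^p_{n+1}=\sum_{q\in\mathcal{K}_p,\,\dim q=n}K^q_n$), and the differential induced by that of $C_*$. Then there is an isomorphism of chain complexes of $R$-modules $$C^{\mathcal{K}_\Delta}_*(\mathcal{P}(\Delta);R)\;\cong\;C_*(\Delta;R),$$ where $C_*(\Delta;R)$ is the (non-augmented) simplicial chain complex of $\Delta$ with coefficients in $R$, whose differential is $\{v_0<\dots<v_n\}\mapsto\sum_{i=0}^n(-1)^i\{v_0,\dots,\widehat{v_i},\dots,v_n\}$. -/

import Mathlib

set_option linter.unusedSectionVars false

noncomputable section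

namespace LocalCovering

open Finset

section Boundary

variable {P : Type*} [PartialOrder P] (R : Type*) [CommRing R]

open Classical in
/-- The sign `(-1) ^ i`, where `i` is the number of elements of `s` below `x`: if
`s = {x₀ < ... < xₙ}` is a chain and `x = xᵢ`, then this is `(-1) ^ i`. -/
def sgn (s : Finset P) (x : P) : R := (-1) ^ (s.filter (fun y => y < x)).card

open Classical in
/-- The simplicial boundary operator on the free module on finite subsets of `P`:
`∂ {x₀ < ... < xₙ} = ∑ i, (-1) ^ i {x₀ < ... < xₙ} ∖ {xᵢ}`. It is only used on finite chains
(`n`-simplices are chains with `n + 1` elements); on vertices it is the augmentation `{x₀} ↦ ∅`. -/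
def boundary : (Finset P →₀ R) →ₗ[R] (Finset P →₀ R) :=
  Finsupp.linearCombination R
    (fun s : Finset P => ∑ x ∈ s, Finsupp.single (s.erase x) (sgn R s x))

open Classical in
theorem boundary_single (s : Finset P) (a : R) :
    boundary R (Finsupp.single s a)
      = ∑ x ∈ s, Finsupp.single (s.erase x) (a * sgn R s x) := by
  simp [boundary, Finsupp.linearCombination_single, Finset.smul_sum]

theorem boundary_single_mem (s : Finset P) (a : R) :
    boundary R (Finsupp.single s a) ∈
      Finsupp.supported R R {t : Finset P | t ⊆ s ∧ t.card + 1 = s.card} := by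
  classical
  rw [boundary_single]
  exact Submodule.sum_mem _ fun x hx => Finsupp.single_mem_supported R _
    ⟨Finset.erase_subset _ _, Finset.card_erase_add_one hx⟩

/-- Linear maps agreeing on the basis elements of `A` agree on `supported R R A` -/
theorem supported_induction {A : Set (Finset P)} {N : Type*} [AddCommGroup N] [Module R N]
    (f g : (Finset P →₀ R) →ₗ[R] N)
    (h : ∀ s ∈ A, f (Finsupp.single s 1) = g (Finsupp.single s 1))
    {z : Finset P →₀ R} (hz : z ∈ Finsupp.supported R R A) : f z = g z := by
  rw [Finsupp.supported_eq_span_single] at hz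
  refine LinearMap.eqOn_span (s := (fun i => Finsupp.single i (1 : R)) '' A) ?_ hz
  rintro _ ⟨s, hs, rfl⟩
  exact h s hs

theorem supported_sub {A B : Set (Finset P)} {z : Finset P →₀ R}
    (hz : z ∈ Finsupp.supported R R A) (h : ∀ s ∈ A, s ∈ B) : z ∈ Finsupp.supported R R B :=
  Finsupp.supported_mono h hz

theorem supported_map_le {A : Set (Finset P)} {N : Type*} [AddCommGroup N] [Module R N]
    (f : (Finset P →₀ R) →ₗ[R] N) (M : Submodule R N)
    (h : ∀ s ∈ A, f (Finsupp.single s 1) ∈ M)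
    {z : Finset P →₀ R} (hz : z ∈ Finsupp.supported R R A) : f z ∈ M := by
  have : Finsupp.supported R R A ≤ M.comap f := by
    rw [Finsupp.supported_eq_span_single, Submodule.span_le]
    rintro _ ⟨s, hs, rfl⟩
    exact h s hs
  exact this hz

open Classical in
theorem sgn_erase_of_not_lt (s : Finset P) {x y : P} (h : ¬ x < y) :
    sgn R (s.erase x) y = sgn R s y := by
  unfold sgn
  congr 2
  ext w
  simp only [Finset.mem_filter, Finset.mem_erase]
  constructor
  · rintro ⟨⟨_, h1⟩, h2⟩; exact ⟨h1, h2⟩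
  · rintro ⟨h1, h2⟩; exact ⟨⟨fun e => h (e ▸ h2), h1⟩, h2⟩

open Classical in
theorem sgn_erase_of_lt (s : Finset P) {x y : P} (hx : x ∈ s) (h : x < y) :
    sgn R (s.erase x) y = - sgn R s y := by
  unfold sgn
  have e : (s.filter (fun w => w < y)) = insert x ((s.erase x).filter (fun w => w < y)) := by
    ext w
    simp only [Finset.mem_filter, Finset.mem_erase, Finset.mem_insert]
    by_cases hw : w = x
    · subst hw; simp [hx, h]
    · simp [hw]
  rw [e, Finset.card_insert_of_notMem (by simp), pow_succ]
  simp

open Classical in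
theorem boundary_boundary_single (s : Finset P) (hs : IsChain (· ≤ ·) (s : Set P)) (a : R) :
    boundary R (boundary R (Finsupp.single s a)) = 0 := by
  rw [boundary_single, map_sum]
  simp only [boundary_single]
  rw [Finset.sum_sigma']
  refine Finset.sum_involution (fun q _ => ⟨q.2, q.1⟩) ?_ ?_ ?_ ?_
  · rintro ⟨x, y⟩ h
    simp only [Finset.mem_sigma, Finset.mem_erase] at h
    obtain ⟨hx, hyx, hy⟩ := h
    dsimp only
    rw [Finset.erase_right_comm, ← Finsupp.single_add]
    have key : a * sgn R s x * sgn R (s.erase x) y + a * sgn R s y * sgn R (s.erase y) x = 0 := by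
      rcases hs (Finset.mem_coe.2 hx) (Finset.mem_coe.2 hy) (Ne.symm hyx) with h | h
      · have h := lt_of_le_of_ne h (Ne.symm hyx)
        rw [sgn_erase_of_lt R s hx h, sgn_erase_of_not_lt R s h.asymm]; ring
      · have h := lt_of_le_of_ne h hyx
        rw [sgn_erase_of_lt R s hy h, sgn_erase_of_not_lt R s h.asymm]; ring
    rw [key, Finsupp.single_zero]
  · rintro ⟨x, y⟩ h _ e
    simp only [Finset.mem_sigma, Finset.mem_erase] at h
    simp only [Sigma.mk.injEq] at e
    exact h.2.1 e.1
  · rintro ⟨x, y⟩ h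
    simp only [Finset.mem_sigma, Finset.mem_erase] at h ⊢
    exact ⟨h.2.2, Ne.symm h.2.1, h.1⟩
  · rintro ⟨x, y⟩ h; rfl

theorem boundary_boundary {z : Finset P →₀ R}
    (hz : z ∈ Finsupp.supported R R {s : Finset P | IsChain (· ≤ ·) (s : Set P)}) :
    boundary R (boundary R z) = 0 := by
  have h := supported_induction R (A := {s : Finset P | IsChain (· ≤ ·) (s : Set P)})
    ((boundary R).comp (boundary R)) 0 (by
      intro s hs
      rw [LinearMap.comp_apply, LinearMap.zero_apply]
      exact boundary_boundary_single R s hs 1) hz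
  rwa [LinearMap.comp_apply, LinearMap.zero_apply] at h

/-- Truncation at `q`: a chain containing `q` loses `q`, other chains go to `0`. -/
def trunc (q : P) : (Finset P →₀ R) →ₗ[R] (Finset P →₀ R) :=
  open Classical in
  Finsupp.linearCombination R
    (fun s : Finset P => if q ∈ s then Finsupp.single (s.erase q) 1 else 0)

/-- Suspension at `q`: adds the element `q` to a chain. -/
def susp (q : P) : (Finset P →₀ R) →ₗ[R] (Finset P →₀ R) :=
  open Classical in
  Finsupp.linearCombination R (fun s : Finset P => Finsupp.single (insert q s) 1)

open Classical in
theorem trunc_single (q : P) (s : Finset P) (a : R) :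
    trunc R q (Finsupp.single s a) = if q ∈ s then Finsupp.single (s.erase q) a else 0 := by
  simp only [trunc, Finsupp.linearCombination_single]
  split_ifs <;> simp

open Classical in
theorem susp_single (q : P) (s : Finset P) (a : R) :
    susp R q (Finsupp.single s a) = Finsupp.single (insert q s) a := by
  simp [susp, Finsupp.linearCombination_single]

open Classical in
theorem trunc_apply (q : P) (z : Finset P →₀ R) (s : Finset P) (hs : q ∉ s) :
    trunc R q z s = z (insert q s) := by
  induction z using Finsupp.induction_linear with
  | zero => simp
  | add f g hf hg => simp [hf, hg]
  | single t a =>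
    rw [trunc_single]
    by_cases hq : q ∈ t
    · rw [if_pos hq, Finsupp.single_apply, Finsupp.single_apply]
      congr 1
      apply propext
      constructor
      · rintro rfl; exact (Finset.insert_erase hq).symm
      · rintro rfl; exact Finset.erase_insert hs
    · rw [if_neg hq, Finsupp.single_apply, if_neg]
      · rfl
      · rintro rfl; exact hq (Finset.mem_insert_self _ _)

open Classical in
theorem susp_apply_of_notMem (q : P) (z : Finset P →₀ R) (s : Finset P) (hs : q ∉ s) :
    susp R q z s = 0 := by
  induction z using Finsupp.induction_linear with
  | zero => simp
  | add f g hf hg => simp [hf, hg]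
  | single t a =>
    rw [susp_single, Finsupp.single_apply, if_neg]
    rintro rfl; exact hs (Finset.mem_insert_self _ _)

open Classical in
theorem susp_apply_of_mem (q : P) {z : Finset P →₀ R}
    (hz : z ∈ Finsupp.supported R R {s : Finset P | ∀ x ∈ s, x < q})
    (s : Finset P) (hs : q ∈ s) : susp R q z s = z (s.erase q) := by
  refine supported_induction R ((Finsupp.lapply s).comp (susp R q))
    (Finsupp.lapply (s.erase q)) ?_ hz
  intro t ht
  have hq : q ∉ t := fun h => lt_irrefl _ (ht q h)
  simp only [LinearMap.comp_apply, Finsupp.lapply_apply, susp_single, Finsupp.single_apply]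
  congr 1
  apply propext
  constructor
  · rintro rfl; exact (Finset.erase_insert hq).symm
  · rintro rfl; exact Finset.insert_erase hs

open Classical in
theorem boundary_susp (q : P) (n : ℕ) {z : Finset P →₀ R}
    (hz : z ∈ Finsupp.supported R R {s : Finset P | s.card = n ∧ ∀ x ∈ s, x < q}) :
    boundary R (susp R q z) = susp R q (boundary R z) + (-1 : R) ^ n • z := by
  refine supported_induction R ((boundary R).comp (susp R q))
    ((susp R q).comp (boundary R) + (-1 : R) ^ n • LinearMap.id) ?_ hz
  rintro s ⟨hn, hs⟩
  have hq : q ∉ s := fun h => lt_irrefl _ (hs q h)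
  simp only [LinearMap.comp_apply, LinearMap.add_apply, LinearMap.smul_apply, LinearMap.id_apply,
    susp_single, boundary_single, map_sum]
  rw [Finset.sum_insert hq, add_comm]
  congr 1
  · refine Finset.sum_congr rfl fun x hx => ?_
    have hxq : q ≠ x := fun h => hq (h ▸ hx)
    rw [Finset.erase_insert_of_ne hxq]
    congr 2
    have := sgn_erase_of_not_lt R (insert q s) (x := q) (y := x) (hs x hx).asymm
    rw [Finset.erase_insert hq] at this
    exact this.symm
  · rw [Finset.erase_insert hq, Finsupp.smul_single]
    congr 1
    simp only [sgn, one_mul, smul_eq_mul, mul_one]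
    congr 1
    rw [← hn]
    congr 1
    ext w
    simp only [Finset.mem_filter, Finset.mem_insert]
    constructor
    · rintro ⟨rfl | h, h2⟩
      · exact absurd h2 (lt_irrefl _)
      · exact h
    · intro h; exact ⟨Or.inr h, hs w h⟩

open Classical in
theorem boundary_trunc (q : P) {z : Finset P →₀ R}
    (hz : z ∈ Finsupp.supported R R {s : Finset P | q ∈ s → ∀ x ∈ s, x ≤ q}) :
    boundary R (trunc R q z) = trunc R q (boundary R z) := by
  refine supported_induction R ((boundary R).comp (trunc R q))
    ((trunc R q).comp (boundary R)) ?_ hz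
  intro s hs
  simp only [LinearMap.comp_apply, trunc_single, boundary_single, map_sum]
  by_cases hq : q ∈ s
  · rw [if_pos hq, boundary_single, ← Finset.add_sum_erase s _ hq]
    simp only [Finset.mem_erase, ne_eq, not_true_eq_false, false_and, if_false, zero_add]
    refine Finset.sum_congr rfl fun x hx => ?_
    obtain ⟨hxq, hx⟩ := Finset.mem_erase.1 hx
    rw [if_pos ⟨Ne.symm hxq, hq⟩, Finset.erase_right_comm,
      sgn_erase_of_not_lt R s (fun h => (hs hq x hx).not_gt h)]
  · rw [if_neg hq, map_zero]
    refine (Finset.sum_eq_zero fun x hx => ?_).symm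
    rw [if_neg (fun h => hq (Finset.mem_of_mem_erase h))]

end Boundary


section Graded

variable (P : Type*) [PartialOrder P] [GradeMinOrder ℕ P]

variable {P} in
/-- The dimension function on `P` with a new minimum `⊥` of dimension `-1` added. A grading of a
poset is a `GradeMinOrder ℕ`: strictly monotone, `dim p = dim q + 1` if `p` covers `q`, and `0` on
minimal elements. -/
def dim : WithBot P → ℤ
  | ⊥ => -1
  | (p : P) => grade ℕ p

/-- A local covering family on a graded poset `P`: subsets `K p` of the elements `≤ p` of
`P ∪ {⊥}`, and maps `η p` from `K p` to the elements `≤ p` that are not in `K p`. -/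
structure LocalCoveringFamily where
  /-- The subposet `K_p`. -/
  K : P → Set (WithBot P)
  le_of_mem : ∀ p, ∀ x ∈ K p, x ≤ (p : WithBot P)
  /-- The map `η_p`. -/
  η : ∀ p : P, K p → WithBot P
  η_le : ∀ p (x : K p), η p x ≤ (p : WithBot P)
  η_notMem : ∀ p (x : K p), η p x ∉ K p
  bot_mem : ∀ p, ⊥ ∈ K p
  lt_η : ∀ p (x : K p), (x : WithBot P) < η p x
  dim_η : ∀ p (x : K p), dim (η p x) = dim (x : WithBot P) + 1
  η_bot : ∀ p q : P, q ≤ p → (q : WithBot P) ∉ K p → η p ⟨⊥, bot_mem p⟩ = η q ⟨⊥, bot_mem q⟩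
  η_mono : ∀ p (x y : K p), (x : WithBot P) ≤ y → η p x ≤ η p y
  η_le_of_notMem : ∀ p (x : K p) (r : WithBot P), r ∉ K p → (x : WithBot P) ≤ r →
    r ≤ (p : WithBot P) → η p x ≤ r

end Graded

section Core

variable {P : Type*} [PartialOrder P] [GradeMinOrder ℕ P] (R : Type*) [CommRing R]
  (𝒦 : LocalCoveringFamily P)

theorem grade_lt {p q : P} (h : p < q) : grade ℕ p < grade ℕ q := grade_strictMono h

theorem dim_bot : dim (⊥ : WithBot P) = -1 := rfl
theorem dim_coe (p : P) : dim (p : WithBot P) = grade ℕ p := rfl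

theorem grade_injOn {s : Finset P} (hs : IsChain (· ≤ ·) (s : Set P)) :
    Set.InjOn (grade ℕ) (s : Set P) := by
  intro x hx y hy h
  by_contra hne
  rcases hs hx hy hne with h' | h'
  · exact (grade_lt (lt_of_le_of_ne h' hne)).ne h
  · exact (grade_lt (lt_of_le_of_ne h' (Ne.symm hne))).ne h.symm

theorem card_le_of_grade_lt {s : Finset P} (hs : IsChain (· ≤ ·) (s : Set P)) {n : ℕ}
    (h : ∀ x ∈ s, grade ℕ x < n) : s.card ≤ n := by
  have := Finset.card_le_card_of_injOn (t := Finset.range n) (grade ℕ)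
    (fun x hx => Finset.mem_coe.2 (Finset.mem_range.2 (h x hx))) (grade_injOn hs)
  simpa using this

theorem exists_grade_eq {s : Finset P} (hs : IsChain (· ≤ ·) (s : Set P)) {n : ℕ}
    (h : ∀ x ∈ s, grade ℕ x < n) (hc : s.card = n) {k : ℕ} (hk : k < n) :
    ∃ x ∈ s, grade ℕ x = k := by
  classical
  have h1 : s.image (grade ℕ) = Finset.range n := by
    refine Finset.eq_of_subset_of_card_le ?_ ?_
    · intro k hk
      obtain ⟨x, hx, rfl⟩ := Finset.mem_image.1 hk
      exact Finset.mem_range.2 (h x hx)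
    · rw [Finset.card_image_of_injOn (grade_injOn hs), hc, Finset.card_range]
  have := h1 ▸ Finset.mem_range.2 hk
  exact Finset.mem_image.1 this

/-- The finite chains of elements `< q`, none of them in `(K_q)_{dim q - 1}`. They form an acyclic
complex, which is used to show that the coordinate maps below are bijective. -/
def iflags (q : P) : Set (Finset P) :=
  {s | IsChain (· ≤ ·) (s : Set P) ∧ (∀ x ∈ s, x < q) ∧
    ∀ x ∈ s, (x : WithBot P) ∈ 𝒦.K q → grade ℕ x + 1 < grade ℕ q}

/-- `x` is the largest element of `s ∪ {⊥}` that lies in `K_q`. -/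
def IsLast (q : P) (s : Finset P) (x : WithBot P) : Prop :=
  (x = ⊥ ∨ ∃ y ∈ s, (y : WithBot P) = x) ∧ x ∈ 𝒦.K q ∧
    ∀ y ∈ s, (y : WithBot P) ∈ 𝒦.K q → (y : WithBot P) ≤ x

theorem exists_isLast (q : P) (s : Finset P) (hs : IsChain (· ≤ ·) (s : Set P)) :
    ∃ x, IsLast 𝒦 q s x := by
  classical
  by_cases h : (s.filter (fun y : P => (y : WithBot P) ∈ 𝒦.K q)).Nonempty
  · obtain ⟨m, hm, hmax⟩ := Finset.exists_max_image _ (grade ℕ) h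
    rw [Finset.mem_filter] at hm
    refine ⟨m, Or.inr ⟨m, hm.1, rfl⟩, hm.2, fun y hy hyK => ?_⟩
    have hg := hmax y (Finset.mem_filter.2 ⟨hy, hyK⟩)
    rw [WithBot.coe_le_coe]
    by_contra hle
    have hne : m ≠ y := fun e => hle e.ge
    rcases hs (Finset.mem_coe.2 hm.1) (Finset.mem_coe.2 hy) hne with h' | h'
    · exact (grade_lt (lt_of_le_of_ne h' hne)).not_ge hg
    · exact hle h'
  · refine ⟨⊥, Or.inl rfl, 𝒦.bot_mem q, fun y hy hyK => ?_⟩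
    exact absurd ⟨y, Finset.mem_filter.2 ⟨hy, hyK⟩⟩ h

theorem IsLast.unique {q : P} {s : Finset P} {x y : WithBot P} (hx : IsLast 𝒦 q s x)
    (hy : IsLast 𝒦 q s y) : x = y := by
  have aux : ∀ {x y : WithBot P}, IsLast 𝒦 q s x → IsLast 𝒦 q s y → x ≤ y := by
    intro x y hx hy
    rcases hx.1 with rfl | ⟨w, hw, rfl⟩
    · exact bot_le
    · exact hy.2.2 w hw hx.2.1
  exact le_antisymm (aux hx hy) (aux hy hx)

open Classical in
/-- the number of elements of `s` above its last element in `K_q` -/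
def pot (q : P) (s : Finset P) : ℕ :=
  (s.filter (fun y : P => ∀ x, IsLast 𝒦 q s x → x < (y : WithBot P))).card

open Classical in
theorem pot_eq {q : P} {s : Finset P} {x : WithBot P} (h : IsLast 𝒦 q s x) :
    pot 𝒦 q s = (s.filter (fun y : P => x < (y : WithBot P))).card := by
  unfold pot
  congr 1
  ext y
  simp only [Finset.mem_filter, and_congr_right_iff]
  intro _
  exact ⟨fun h' => h' x h, fun h' x' hx' => (IsLast.unique 𝒦 h hx') ▸ h'⟩

open Classical in
theorem pot_le_card (q : P) (s : Finset P) : pot 𝒦 q s ≤ s.card := by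
  unfold pot
  exact Finset.card_filter_le _ _

/-- `s` contains `η_q` of its last element in `K_q` -/
def IsB (q : P) (s : Finset P) : Prop :=
  ∃ (x : WithBot P) (hx : IsLast 𝒦 q s x), ∃ e ∈ s, (e : WithBot P) = 𝒦.η q ⟨x, hx.2.1⟩

theorem IsLast.of_subset {q : P} {s t : Finset P} {x : WithBot P} (h : IsLast 𝒦 q s x)
    (ht : t ⊆ s) (hx : x = ⊥ ∨ ∃ y ∈ t, (y : WithBot P) = x) : IsLast 𝒦 q t x :=
  ⟨hx, h.2.1, fun y hy => h.2.2 y (ht hy)⟩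

open Classical in
theorem face_cases {q : P} {s : Finset P} (hs : IsChain (· ≤ ·) (s : Set P)) {x : WithBot P}
    (hx : IsLast 𝒦 q s x) {e : P} (he : e ∈ s) (hex : (e : WithBot P) = 𝒦.η q ⟨x, hx.2.1⟩)
    {y : P} (hy : y ∈ s) (hye : y ≠ e) :
    IsB 𝒦 q (s.erase y) ∨ pot 𝒦 q s ≤ pot 𝒦 q (s.erase y) := by
  by_cases hyx : (y : WithBot P) = x
  · right
    obtain ⟨x', hx'⟩ := exists_isLast 𝒦 q (s.erase y)
      (hs.mono (by simp))
    rw [pot_eq 𝒦 hx, pot_eq 𝒦 hx']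
    refine Finset.card_le_card fun w hw => ?_
    simp only [Finset.mem_filter, Finset.mem_erase] at hw ⊢
    refine ⟨⟨?_, hw.1⟩, lt_of_le_of_lt ?_ hw.2⟩
    · rintro rfl; exact absurd hw.2 (by simp [hyx])
    · rcases hx'.1 with rfl | ⟨w', hw', rfl⟩
      · exact bot_le
      · exact hx.2.2 w' (Finset.mem_of_mem_erase hw') hx'.2.1
  · left
    refine ⟨x, hx.of_subset 𝒦 (Finset.erase_subset _ _) ?_, e,
      Finset.mem_erase.2 ⟨Ne.symm hye, he⟩, hex⟩
    rcases hx.1 with h | ⟨w, hw, hwx⟩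
    · exact Or.inl h
    · refine Or.inr ⟨w, Finset.mem_erase.2 ⟨?_, hw⟩, hwx⟩
      rintro rfl; exact hyx hwx

open Classical in
theorem isLast_erase {q : P} {s : Finset P} {x : WithBot P}
    (hx : IsLast 𝒦 q s x) {e : P} (hex : (e : WithBot P) = 𝒦.η q ⟨x, hx.2.1⟩) :
    IsLast 𝒦 q (s.erase e) x := by
  refine hx.of_subset 𝒦 (Finset.erase_subset _ _) ?_
  rcases hx.1 with h | ⟨w, hw, hwx⟩
  · exact Or.inl h
  · refine Or.inr ⟨w, Finset.mem_erase.2 ⟨?_, hw⟩, hwx⟩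
    rintro rfl
    refine 𝒦.η_notMem q ⟨x, hx.2.1⟩ ?_
    rw [← hex, hwx]
    exact hx.2.1

open Classical in
theorem pot_erase {q : P} {s : Finset P} {x : WithBot P}
    (hx : IsLast 𝒦 q s x) {e : P} (he : e ∈ s) (hex : (e : WithBot P) = 𝒦.η q ⟨x, hx.2.1⟩) :
    pot 𝒦 q s = pot 𝒦 q (s.erase e) + 1 := by
  rw [pot_eq 𝒦 hx, pot_eq 𝒦 (isLast_erase 𝒦 hx hex), Finset.filter_erase,
    Finset.card_erase_add_one]
  rw [Finset.mem_filter]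
  exact ⟨he, hex ▸ 𝒦.lt_η q ⟨x, hx.2.1⟩⟩

open Classical in
theorem not_isB_erase {q : P} {s : Finset P} {x : WithBot P}
    (hx : IsLast 𝒦 q s x) {e : P} (hex : (e : WithBot P) = 𝒦.η q ⟨x, hx.2.1⟩) :
    ¬ IsB 𝒦 q (s.erase e) := by
  rintro ⟨x', hx', e', he', hex'⟩
  obtain rfl := IsLast.unique 𝒦 hx' (isLast_erase 𝒦 hx hex)
  rw [← hex, WithBot.coe_inj] at hex'
  exact (Finset.mem_erase.1 he').1 hex'

open Classical in
theorem boundary_apply (z : Finset P →₀ R) (t : Finset P) :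
    boundary R z t = ∑ s ∈ z.support, ∑ y ∈ s, if s.erase y = t then z s * sgn R s y else 0 := by
  conv_lhs => rw [← Finsupp.sum_single z, Finsupp.sum, map_sum]
  simp only [boundary_single, Finsupp.finsetSum_apply, Finsupp.single_apply]

theorem sgn_mul_self (s : Finset P) (x : P) : sgn R s x * sgn R s x = 1 := by
  unfold sgn
  rw [← mul_pow]; simp

open Classical in
theorem eq_zero_of_isB {q : P} {z : Finset P →₀ R}
    (hz : z ∈ Finsupp.supported R R
      {s : Finset P | IsChain (· ≤ ·) (s : Set P) ∧ IsB 𝒦 q s})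
    (hd : boundary R z = 0) : z = 0 := by
  by_contra hne
  obtain ⟨s, hs, hmin⟩ := Finset.exists_min_image z.support (pot 𝒦 q)
    (Finsupp.support_nonempty_iff.2 hne)
  obtain ⟨hsc, x, hx, e, he, hex⟩ := hz hs
  have h0 : boundary R z (s.erase e) = 0 := by rw [hd]; rfl
  rw [boundary_apply, Finset.sum_eq_single s, Finset.sum_eq_single e] at h0
  · rw [if_pos rfl] at h0
    refine (Finsupp.mem_support_iff.1 hs) ?_
    calc z s = z s * sgn R s e * sgn R s e := by rw [mul_assoc, sgn_mul_self, mul_one]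
      _ = 0 := by rw [h0, zero_mul]
  · intro y hy hye
    rw [if_neg]
    intro h
    have : e ∈ s.erase y := Finset.mem_erase.2 ⟨Ne.symm hye, he⟩
    rw [h] at this
    simp at this
  · intro h; exact absurd he h
  · intro s' hs' hss'
    refine Finset.sum_eq_zero fun y hy => if_neg fun h => ?_
    obtain ⟨hsc', x', hx', e', he', hex'⟩ := hz hs'
    have hle := hmin s' hs'
    by_cases hye : y = e'
    · subst hye
      have h1 := isLast_erase 𝒦 hx' hex'
      rw [h] at h1
      obtain rfl := IsLast.unique 𝒦 h1 (isLast_erase 𝒦 hx hex)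
      rw [← hex, WithBot.coe_inj] at hex'
      subst hex'
      apply hss'
      rw [← Finset.insert_erase hy, h, Finset.insert_erase he]
    · rcases face_cases 𝒦 hsc' hx' he' hex' hy hye with hB | hp
      · rw [h] at hB
        exact not_isB_erase 𝒦 hx hex hB
      · rw [h] at hp
        have := pot_erase 𝒦 hx he hex
        omega
  · intro h; exact absurd hs h

open Classical in
theorem insert_mem_iflags {q : P} (hq : 0 < grade ℕ q) {s : Finset P} (hs : s ∈ iflags 𝒦 q)
    (hA : ¬ IsB 𝒦 q s) :
    ∃ (x : WithBot P) (e : P) (hx : IsLast 𝒦 q (insert e s) x), e ∉ s ∧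
      insert e s ∈ iflags 𝒦 q ∧ (e : WithBot P) = 𝒦.η q ⟨x, hx.2.1⟩ := by
  obtain ⟨x, hx⟩ := exists_isLast 𝒦 q s hs.1
  obtain ⟨e, he⟩ := WithBot.ne_bot_iff_exists.1 (bot_le.trans_lt (𝒦.lt_η q ⟨x, hx.2.1⟩)).ne'
  have hes : e ∉ s := fun h => hA ⟨x, hx, e, h, he⟩
  have heK : (e : WithBot P) ∉ 𝒦.K q := he ▸ 𝒦.η_notMem q _
  have hxe : x < e := he ▸ 𝒦.lt_η q ⟨x, hx.2.1⟩
  have hlast : IsLast 𝒦 q (insert e s) x := by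
    refine ⟨?_, hx.2.1, fun y hy hyK => ?_⟩
    · rcases hx.1 with h | ⟨w, hw, h⟩
      · exact Or.inl h
      · exact Or.inr ⟨w, Finset.mem_insert_of_mem hw, h⟩
    · rcases Finset.mem_insert.1 hy with rfl | hy
      · exact absurd hyK heK
      · exact hx.2.2 y hy hyK
  have heq : e < q := by
    refine lt_of_le_of_ne (WithBot.coe_le_coe.1 (he ▸ 𝒦.η_le q _)) ?_
    rintro rfl
    have hd := 𝒦.dim_η e ⟨x, hx.2.1⟩
    rw [← he, dim_coe] at hd
    rcases hx.1 with rfl | ⟨w, hw, rfl⟩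
    · rw [dim_bot] at hd; omega
    · have := hs.2.2 w hw hx.2.1
      rw [dim_coe] at hd; omega
  refine ⟨x, e, hlast, hes, ⟨?_, ?_, ?_⟩, he⟩
  · rw [Finset.coe_insert]
    refine hs.1.insert fun y hy hne => ?_
    by_cases hyK : (y : WithBot P) ∈ 𝒦.K q
    · right
      exact WithBot.coe_le_coe.1 ((hx.2.2 y hy hyK).trans hxe.le)
    · have hcmp : x ≤ y ∨ (y : WithBot P) ≤ x := by
        rcases hx.1 with rfl | ⟨w, hw, rfl⟩
        · exact Or.inl bot_le
        · simp only [WithBot.coe_le_coe]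
          exact hs.1.total hw hy
      rcases hcmp with h | h
      · left
        rw [← WithBot.coe_le_coe, he]
        exact 𝒦.η_le_of_notMem q ⟨x, hx.2.1⟩ y hyK h (WithBot.coe_le_coe.2 (hs.2.1 y hy).le)
      · right
        exact WithBot.coe_le_coe.1 (h.trans hxe.le)
  · intro y hy
    rcases Finset.mem_insert.1 hy with rfl | hy
    · exact heq
    · exact hs.2.1 y hy
  · intro y hy hyK
    rcases Finset.mem_insert.1 hy with rfl | hy
    · exact absurd hyK heK
    · exact hs.2.2 y hy hyK

theorem iflags_subset {q : P} {s t : Finset P} (hs : s ∈ iflags 𝒦 q) (h : t ⊆ s) :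
    t ∈ iflags 𝒦 q :=
  ⟨hs.1.mono (Finset.coe_subset.2 h), fun x hx => hs.2.1 x (h hx), fun x hx => hs.2.2 x (h hx)⟩

open Classical in
theorem iflags_decomp {q : P} (hq : 0 < grade ℕ q) (k : ℕ) (m : ℕ) :
    ∀ s ∈ iflags 𝒦 q, s.card = k → k ≤ pot 𝒦 q s + m →
    Finsupp.single s (1 : R) ∈
      Finsupp.supported R R {t : Finset P | t ∈ iflags 𝒦 q ∧ t.card = k ∧ IsB 𝒦 q t} ⊔
      (Finsupp.supported R R
        {t : Finset P | t ∈ iflags 𝒦 q ∧ t.card = k + 1}).map (boundary R) := by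
  induction m using Nat.strong_induction_on with
  | _ m ih =>
  intro s hs hk hm
  by_cases hB : IsB 𝒦 q s
  · exact Submodule.mem_sup_left (Finsupp.single_mem_supported R 1 ⟨hs, hk, hB⟩)
  · obtain ⟨x, e, hx, hes, hI, hex⟩ := insert_mem_iflags 𝒦 hq hs hB
    have hcard : (insert e s).card = k + 1 := by rw [Finset.card_insert_of_notMem hes, hk]
    set M := Finsupp.supported R R {t : Finset P | t ∈ iflags 𝒦 q ∧ t.card = k ∧ IsB 𝒦 q t} ⊔
      (Finsupp.supported R R
        {t : Finset P | t ∈ iflags 𝒦 q ∧ t.card = k + 1}).map (boundary R) with hM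
    have h1 : boundary R (Finsupp.single (insert e s) 1) ∈ M :=
      Submodule.mem_sup_right (Submodule.mem_map_of_mem
        (Finsupp.single_mem_supported R 1 ⟨hI, hcard⟩))
    have hpot : pot 𝒦 q (insert e s) = pot 𝒦 q s + 1 := by
      have := pot_erase 𝒦 hx (Finset.mem_insert_self e s) hex
      rwa [Finset.erase_insert hes] at this
    have h2 : ∑ y ∈ s, Finsupp.single ((insert e s).erase y) (1 * sgn R (insert e s) y) ∈ M := by
      refine Submodule.sum_mem _ fun y hy => ?_
      have hye : y ≠ e := fun h => hes (h ▸ hy)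
      have hy' : y ∈ insert e s := Finset.mem_insert_of_mem hy
      have hyI := iflags_subset 𝒦 hI (Finset.erase_subset y _)
      have hyc : ((insert e s).erase y).card = k := by
        rw [Finset.card_erase_of_mem hy', hcard]; rfl
      have : Finsupp.single ((insert e s).erase y) (1 : R) ∈ M := by
        rcases face_cases 𝒦 hI.1 hx (Finset.mem_insert_self e s) hex hy' hye with hB' | hp
        · exact Submodule.mem_sup_left (Finsupp.single_mem_supported R 1 ⟨hyI, hyc, hB'⟩)
        · have hle : pot 𝒦 q s ≤ k := by
            rw [← hk]; exact pot_le_card 𝒦 q s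
          rcases Nat.eq_zero_or_pos m with rfl | hm0
          · have : pot 𝒦 q ((insert e s).erase y) ≤ k := by
              rw [← hyc]; exact pot_le_card 𝒦 q _
            omega
          · exact ih (m - 1) (by omega) _ hyI hyc (by omega)
      have h3 := M.smul_mem (1 * sgn R (insert e s) y) this
      rwa [Finsupp.smul_single, smul_eq_mul, mul_one] at h3
    rw [boundary_single, Finset.sum_insert hes, Finset.erase_insert hes] at h1
    have h4 := (Submodule.add_mem_iff_left M h2).1 h1
    have h5 := M.smul_mem (sgn R (insert e s) e) h4
    rwa [Finsupp.smul_single, smul_eq_mul, one_mul, sgn_mul_self] at h5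

open Classical in
theorem exists_boundary_eq {q : P} (hq : 0 < grade ℕ q) (k : ℕ) {z : Finset P →₀ R}
    (hz : z ∈ Finsupp.supported R R {t : Finset P | t ∈ iflags 𝒦 q ∧ t.card = k})
    (hd : boundary R z = 0) :
    ∃ w ∈ Finsupp.supported R R {t : Finset P | t ∈ iflags 𝒦 q ∧ t.card = k + 1},
      boundary R w = z := by
  have h := supported_map_le R (A := {t : Finset P | t ∈ iflags 𝒦 q ∧ t.card = k})
    LinearMap.id _
    (fun s (hs : s ∈ iflags 𝒦 q ∧ s.card = k) => iflags_decomp R 𝒦 hq k k s hs.1 hs.2 (by omega)) hz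
  obtain ⟨b, hb, _, ⟨w, hw, rfl⟩, hbw⟩ := Submodule.mem_sup.1 h
  refine ⟨w, hw, ?_⟩
  rw [LinearMap.id_apply] at hbw
  have hww : boundary R (boundary R w) = 0 :=
    boundary_boundary R (supported_sub R hw (fun t ht => ht.1.1))
  have hb0 : b = 0 := by
    refine eq_zero_of_isB R 𝒦 (q := q)
      (supported_sub R hb (fun t ht => ⟨ht.1.1, ht.2.2⟩)) ?_
    rw [← hbw, map_add, hww, add_zero] at hd
    exact hd
  rw [← hbw, hb0, zero_add]

theorem isB_of_card {q : P} (hq : 0 < grade ℕ q) {s : Finset P} (hs : s ∈ iflags 𝒦 q)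
    (hc : s.card = grade ℕ q) : IsB 𝒦 q s := by
  obtain ⟨x, hx⟩ := exists_isLast 𝒦 q s hs.1
  have hgr : ∀ y ∈ s, grade ℕ y < grade ℕ q := fun y hy => grade_lt (hs.2.1 y hy)
  obtain ⟨k, hk, hkx⟩ : ∃ k : ℕ, k < grade ℕ q ∧ (k : ℤ) = dim x + 1 := by
    rcases hx.1 with rfl | ⟨w, hw, rfl⟩
    · exact ⟨0, hq, by rw [dim_bot]; rfl⟩
    · exact ⟨grade ℕ w + 1, hs.2.2 w hw hx.2.1, by rw [dim_coe]; push_cast; rfl⟩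
  obtain ⟨y, hy, hyk⟩ := exists_grade_eq hs.1 hgr hc hk
  have hyK : (y : WithBot P) ∉ 𝒦.K q := by
    intro h
    have h2 := hx.2.2 y hy h
    rcases hx.1 with rfl | ⟨w, hw, rfl⟩
    · simp at h2
    · have := (grade_strictMono (𝕆 := ℕ)).monotone (WithBot.coe_le_coe.1 h2)
      rw [dim_coe] at hkx; omega
  have hxy : x ≤ y := by
    rcases hx.1 with rfl | ⟨w, hw, rfl⟩
    · exact bot_le
    · rw [WithBot.coe_le_coe]
      rcases hs.1.total hw hy with h | h
      · exact h
      · have := (grade_strictMono (𝕆 := ℕ)).monotone h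
        rw [dim_coe] at hkx; omega
  have hle := 𝒦.η_le_of_notMem q ⟨x, hx.2.1⟩ y hyK hxy (WithBot.coe_le_coe.2 (hs.2.1 y hy).le)
  obtain ⟨e, he⟩ := WithBot.ne_bot_iff_exists.1 (bot_le.trans_lt (𝒦.lt_η q ⟨x, hx.2.1⟩)).ne'
  have hd := 𝒦.dim_η q ⟨x, hx.2.1⟩
  rw [← he, dim_coe] at hd
  dsimp only at hd
  rw [← he, WithBot.coe_le_coe] at hle
  have : e = y := by
    by_contra hne
    have := grade_lt (lt_of_le_of_ne hle hne)
    omega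
  exact ⟨x, hx, y, hy, this ▸ he⟩

end Core

section Complex

variable (P : Type*) [PartialOrder P] [GradeMinOrder ℕ P] (R : Type*) [CommRing R]

/-- The piece `F_{m-1} C_{k-1}` of the dimension filtration of the augmented chain complex of the
order complex of `P`: the span of the chains with `k` elements, all of dimension `≤ m - 1`. -/
def filtration (m k : ℕ) : Submodule R (Finset P →₀ R) :=
  Finsupp.supported R R
    {c : Finset P | IsChain (· ≤ ·) (c : Set P) ∧ c.card = k ∧ ∀ p ∈ c, grade ℕ p < m}

/-- `H_n (F_n C / F_{n-1} C)`, where `C` is the augmented chain complex of the order complex of `P`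
and `F` is its dimension filtration. Dimensions increase strictly along a chain, so
`F_{n-1} C_n = 0` and `F_n C_{n+1} = 0`, see `filtration_eq_bot`; hence this homology is the module
of all `z ∈ F_n C_n` with `∂ z ∈ F_{n-1} C_{n-1}`. It is the direct sum of the reduced homology
modules `H_{n-1} (P_{<p})` over all `p` of dimension `n`, by truncation at `p`. -/
def relCycles (n : ℕ) : Submodule R (Finset P →₀ R) :=
  filtration P R (n + 1) (n + 1) ⊓ (filtration P R n n).comap (boundary R)

theorem filtration_eq_bot (n : ℕ) : filtration P R n (n + 1) = ⊥ := by
  refine (Submodule.eq_bot_iff _).2 fun z hz => Finsupp.ext fun c => ?_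
  refine (Finsupp.mem_supported' R z).1 hz c ?_
  rintro ⟨h1, h2, h3⟩
  have := card_le_of_grade_lt h1 h3
  omega

/-- For `dim q = n`, the module of cycles of degree `n - 1` (which is the top degree, so this is
reduced homology) of the order complex of the subposet of elements `< q`. -/
def cyclesBelow (q : P) (n : ℕ) : Submodule R (Finset P →₀ R) :=
  Finsupp.supported R R
    {c : Finset P | (IsChain (· ≤ ·) (c : Set P) ∧ c.card = n) ∧ ∀ p ∈ c, p < q} ⊓
  LinearMap.ker (boundary R)

variable {P}

/-- The set of chains `p₀ < ... < pₙ` with `dim pᵢ = i` and `pᵢ ∈ K_{pᵢ₊₁}`. By `ncard_kflags`, the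
number of those with `pₙ = p` is the number `K^p_n`, so the free module on this set is the direct
sum of the modules `R ^ (K^p_n)` over all `p` of dimension `n`. -/
def LocalCoveringFamily.kflags (𝒦 : LocalCoveringFamily P) (n : ℕ) : Set (Finset P) :=
  {c : Finset P | (IsChain (· ≤ ·) (c : Set P) ∧ c.card = n + 1 ∧ ∀ p ∈ c, grade ℕ p < n + 1) ∧
    ∀ p ∈ c, ∀ q ∈ c, grade ℕ q = grade ℕ p + 1 → (p : WithBot P) ∈ 𝒦.K q}

variable (𝒦 : LocalCoveringFamily P)

theorem lt_top_of_mem {c : Finset P} {n : ℕ} {q : P} (hc : IsChain (· ≤ ·) (c : Set P))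
    (hg : ∀ p ∈ c, grade ℕ p < n + 1) (hq : q ∈ c) (hqn : grade ℕ q = n) {x : P} (hx : x ∈ c)
    (hxq : x ≠ q) : x < q := by
  rcases hc hx hq hxq with h | h
  · exact lt_of_le_of_ne h hxq
  · have := grade_lt (lt_of_le_of_ne h hxq.symm)
    have := hg x hx
    omega

theorem trunc_mem {n : ℕ} {z : Finset P →₀ R} (hz : z ∈ relCycles P R n) {q : P}
    (hq : grade ℕ q = n) : trunc R q z ∈ cyclesBelow P R q n := by
  classical
  obtain ⟨hz, hd⟩ := hz
  constructor
  · refine supported_map_le R (trunc R q) _ (fun s hs => ?_) hz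
    rw [trunc_single]
    split_ifs with hqs
    · refine Finsupp.single_mem_supported R 1 ⟨⟨hs.1.mono (by simp), ?_⟩, fun x hx => ?_⟩
      · rw [Finset.card_erase_of_mem hqs, hs.2.1]; rfl
      · obtain ⟨h1, h2⟩ := Finset.mem_erase.1 hx
        exact lt_top_of_mem hs.1 hs.2.2 hqs hq h2 h1
    · exact Submodule.zero_mem _
  · change boundary R (trunc R q z) = 0
    rw [boundary_trunc]
    · have h0 := supported_map_le R (trunc R q) (⊥ : Submodule R (Finset P →₀ R))
        (fun s hs => ?_) hd
      · simpa using h0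
      · rw [trunc_single, if_neg]
        · exact Submodule.zero_mem _
        · intro h; exact (hs.2.2 q h).ne hq
    · refine supported_sub R hz (fun s hs hqs x hx => ?_)
      rcases eq_or_ne x q with rfl | hne
      · exact le_rfl
      · exact (lt_top_of_mem hs.1 hs.2.2 hqs hq hx hne).le

theorem cyclesBelow_le {n : ℕ} {q : P} (hq : grade ℕ q = n + 1) :
    cyclesBelow P R q (n + 1) ≤ relCycles P R n := by
  rintro z ⟨hz, hd⟩
  refine ⟨supported_sub R hz (fun s hs => ⟨hs.1.1, hs.1.2, fun p hp => ?_⟩), ?_⟩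
  · have := grade_lt (hs.2 p hp); omega
  · change boundary R z ∈ filtration P R n n
    rw [LinearMap.mem_ker.1 hd]
    exact Submodule.zero_mem _

open Classical in
theorem kflags_insert {n : ℕ} {p q : P} (hp : grade ℕ p = n) (hpq : (p : WithBot P) ∈ 𝒦.K q)
    (hq : grade ℕ q = n + 1) {c : Finset P} (hc : c ∈ 𝒦.kflags n) (hpc : p ∈ c) :
    insert q c ∈ 𝒦.kflags (n + 1) ∧ q ∉ c := by
  obtain ⟨⟨h1, h2, h3⟩, h4⟩ := hc
  have hqc : q ∉ c := fun h => by have := h3 q h; omega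
  have hltq : p < q := by
    refine lt_of_le_of_ne (WithBot.coe_le_coe.1 (𝒦.le_of_mem q _ hpq)) ?_
    rintro rfl; omega
  have hle : ∀ x ∈ c, x ≤ p := fun x hx => by
    rcases eq_or_ne x p with rfl | hne
    · exact le_rfl
    · exact (lt_top_of_mem h1 h3 hpc hp hx hne).le
  refine ⟨⟨⟨?_, ?_, ?_⟩, ?_⟩, hqc⟩
  · rw [Finset.coe_insert]
    exact h1.insert fun y hy _ => Or.inr ((hle y hy).trans hltq.le)
  · rw [Finset.card_insert_of_notMem hqc, h2]
  · intro x hx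
    rcases Finset.mem_insert.1 hx with rfl | hx
    · omega
    · have := h3 x hx; omega
  · intro x hx y hy hxy
    rcases Finset.mem_insert.1 hy with hy' | hy'
    · rw [hy'] at hxy ⊢
      rcases Finset.mem_insert.1 hx with hx' | hx'
      · rw [hx'] at hxy; omega
      · have hxp : x = p := grade_injOn h1 hx' hpc (by omega)
        rw [hxp]; exact hpq
    · rcases Finset.mem_insert.1 hx with hx' | hx'
      · have := h3 y hy'; rw [hx'] at hxy; omega
      · exact h4 x hx' y hy' hxy

open Classical in
theorem kflags_erase {n : ℕ} {q : P} (hq : grade ℕ q = n + 1) {c : Finset P}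
    (hc : c ∈ 𝒦.kflags (n + 1)) (hqc : q ∈ c) :
    c.erase q ∈ 𝒦.kflags n ∧ ∃ p ∈ c.erase q, grade ℕ p = n ∧ (p : WithBot P) ∈ 𝒦.K q := by
  obtain ⟨⟨h1, h2, h3⟩, h4⟩ := hc
  have hch : IsChain (· ≤ ·) ((c.erase q : Finset P) : Set P) := h1.mono (by simp)
  have hcard : (c.erase q).card = n + 1 := by
    rw [Finset.card_erase_of_mem hqc, h2]; rfl
  have hg : ∀ p ∈ c.erase q, grade ℕ p < n + 1 := fun p hp => by
    obtain ⟨hpq, hp⟩ := Finset.mem_erase.1 hp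
    have := grade_lt (lt_top_of_mem h1 h3 hqc hq hp hpq)
    omega
  refine ⟨⟨⟨hch, hcard, hg⟩, fun x hx y hy => h4 x (Finset.mem_of_mem_erase hx) y
    (Finset.mem_of_mem_erase hy)⟩, ?_⟩
  obtain ⟨p, hp, hpn⟩ := exists_grade_eq hch hg hcard (Nat.lt_succ_self n)
  exact ⟨p, hp, hpn, h4 p (Finset.mem_of_mem_erase hp) q hqc (by omega)⟩

theorem card_zero_eq {c : Finset P} {q : P} (hc : c ∈ 𝒦.kflags 0) (hq : q ∈ c) : c = {q} := by
  obtain ⟨x, rfl⟩ := Finset.card_eq_one.1 hc.1.2.1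
  rw [Finset.mem_singleton] at hq
  rw [hq]

theorem singleton_mem_kflags {q : P} (hq : grade ℕ q = 0) : {q} ∈ 𝒦.kflags 0 := by
  refine ⟨⟨by simp, by simp, by simp [hq]⟩, ?_⟩
  intro x hx y hy h
  simp only [Finset.mem_singleton] at hx hy
  subst hx; subst hy
  omega

/-- The numbers `K^p_n`: `K^p_0 = 1` and `K^p_{n+1}` is the sum of `K^q_n` over `q ∈ (K_p)_n`. -/
def LocalCoveringFamily.rankNumber (𝒦 : LocalCoveringFamily P) : ℕ → P → ℕ
  | 0, _ => 1
  | n + 1, p => ∑ᶠ q ∈ {q : P | grade ℕ q = n ∧ (q : WithBot P) ∈ 𝒦.K p}, 𝒦.rankNumber n q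

theorem ncard_kflags (hfin : ∀ p : P, (Set.Iic p).Finite) (n : ℕ) : ∀ p : P, grade ℕ p = n →
    {c | c ∈ 𝒦.kflags n ∧ p ∈ c}.ncard = 𝒦.rankNumber n p := by
  classical
  induction n with
  | zero =>
    intro p hp
    have h : {c | c ∈ 𝒦.kflags 0 ∧ p ∈ c} = {{p}} := by
      ext c
      constructor
      · rintro ⟨hc, hpc⟩
        exact card_zero_eq 𝒦 hc hpc
      · rintro rfl
        exact ⟨singleton_mem_kflags 𝒦 hp, Finset.mem_singleton_self p⟩
    rw [h, Set.ncard_singleton]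
    rfl
  | succ n ih =>
    intro p hp
    have hflags : ∀ q : P, grade ℕ q = n → {c | c ∈ 𝒦.kflags n ∧ q ∈ c}.Finite := by
      intro q hq
      refine ((hfin q).toFinset.powerset.finite_toSet).subset fun c hc => ?_
      rw [Finset.mem_coe, Finset.mem_powerset]
      intro x hx
      rw [Set.Finite.mem_toFinset, Set.mem_Iic]
      rcases eq_or_ne x q with rfl | hne
      · exact le_rfl
      · exact (lt_top_of_mem hc.1.1.1 hc.1.1.2.2 hc.2 hq hx hne).le
    have hI : {q : P | grade ℕ q = n ∧ (q : WithBot P) ∈ 𝒦.K p}.Finite :=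
      (hfin p).subset fun q hq => WithBot.coe_le_coe.1 (𝒦.le_of_mem p _ hq.2)
    have hU : {c | c ∈ 𝒦.kflags (n + 1) ∧ p ∈ c} =
        ⋃ q ∈ {q : P | grade ℕ q = n ∧ (q : WithBot P) ∈ 𝒦.K p},
          (insert p) '' {c | c ∈ 𝒦.kflags n ∧ q ∈ c} := by
      ext c
      simp only [Set.mem_iUnion]
      constructor
      · rintro ⟨hc, hpc⟩
        obtain ⟨h1, q, hq, hqn, hqK⟩ := kflags_erase 𝒦 hp hc hpc
        exact ⟨q, ⟨hqn, hqK⟩, c.erase p, ⟨h1, hq⟩, Finset.insert_erase hpc⟩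
      · rintro ⟨q, ⟨hqn, hqK⟩, c, ⟨hc, hqc⟩, rfl⟩
        exact ⟨(kflags_insert 𝒦 hqn hqK hp hc hqc).1, Finset.mem_insert_self _ _⟩
    have hinj : ∀ {q q' : P} {c c' : Finset P}, grade ℕ q = n → (q : WithBot P) ∈ 𝒦.K p →
        grade ℕ q' = n → (q' : WithBot P) ∈ 𝒦.K p → c ∈ 𝒦.kflags n → q ∈ c →
        c' ∈ 𝒦.kflags n → q' ∈ c' → insert p c = insert p c' → c = c' := by
      intro q q' c c' h1 h2 h3 h4 hc hqc hc' hqc' h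
      rw [← Finset.erase_insert (kflags_insert 𝒦 h1 h2 hp hc hqc).2, h,
        Finset.erase_insert (kflags_insert 𝒦 h3 h4 hp hc' hqc').2]
    rw [hU, hI.ncard_biUnion]
    · refine finsum_mem_congr rfl fun q hq => ?_
      rw [Set.InjOn.ncard_image, ih q hq.1]
      rintro c ⟨hc, hqc⟩ c' ⟨hc', hqc'⟩ h
      exact hinj hq.1 hq.2 hq.1 hq.2 hc hqc hc' hqc' h
    · intro q hq
      exact (hflags q hq.1).image _
    · intro q hq q' hq' hne
      refine Set.disjoint_left.2 ?_
      rintro _ ⟨c, ⟨hc, hqc⟩, rfl⟩ ⟨c', ⟨hc', hqc'⟩, h⟩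
      have := hinj hq'.1 hq'.2 hq.1 hq.2 hc' hqc' hc hqc h
      subst this
      exact hne (grade_injOn hc.1.1 hqc hqc' (hq.1.trans hq'.1.symm))

open Classical in
theorem eq_zero_of_kflags_below (n : ℕ) : ∀ (q : P), grade ℕ q = n →
    ∀ y ∈ cyclesBelow P R q n, (∀ c ∈ 𝒦.kflags n, q ∈ c → y (c.erase q) = 0) → y = 0 := by
  induction n with
  | zero =>
    rintro q hq y ⟨hy, -⟩ h
    have h0 := h {q} (singleton_mem_kflags 𝒦 hq) (Finset.mem_singleton_self q)
    rw [Finset.erase_singleton] at h0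
    ext s
    by_cases hs : s = ∅
    · rw [hs, h0]; rfl
    · refine (Finsupp.mem_supported' R y).1 hy s fun h' => hs ?_
      exact Finset.card_eq_zero.1 h'.1.2
  | succ n ih =>
    intro q hq y hy h
    have hT : ∀ p : P, grade ℕ p = n → (p : WithBot P) ∈ 𝒦.K q → trunc R p y = 0 := by
      intro p hp hpq
      refine ih p hp _ (trunc_mem R (cyclesBelow_le R hq hy) hp) fun c hc hpc => ?_
      rw [trunc_apply R p y _ (Finset.notMem_erase p c), Finset.insert_erase hpc]
      obtain ⟨h1, h2⟩ := kflags_insert 𝒦 hp hpq hq hc hpc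
      have := h _ h1 (Finset.mem_insert_self q c)
      rwa [Finset.erase_insert h2] at this
    refine eq_zero_of_isB R 𝒦 (q := q) ?_ hy.2
    intro s hs
    obtain ⟨⟨h1, h2⟩, h3⟩ := hy.1 hs
    refine ⟨h1, isB_of_card 𝒦 (by omega) ⟨h1, h3, fun x hx hxK => ?_⟩ (by omega)⟩
    have hlt := grade_lt (h3 x hx)
    by_contra hcon
    have h0 := hT x (by omega) hxK
    have h5 := trunc_apply R x y _ (Finset.notMem_erase x s)
    rw [h0, Finset.insert_erase hx] at h5
    exact (Finsupp.mem_support_iff.1 hs) h5.symm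

open Classical in
theorem exists_dual_below (n : ℕ) : ∀ (q : P), grade ℕ q = n → ∀ c ∈ 𝒦.kflags n, q ∈ c →
    ∃ y ∈ cyclesBelow P R q n, ∀ d ∈ 𝒦.kflags n, q ∈ d →
      y (d.erase q) = if d = c then 1 else 0 := by
  induction n with
  | zero =>
    intro q hq c hc hqc
    refine ⟨Finsupp.single ∅ 1, ⟨Finsupp.single_mem_supported R 1 (by simp), ?_⟩, ?_⟩
    · change boundary R _ = 0
      rw [boundary_single, Finset.sum_empty]
    · intro d hd hqd
      rw [card_zero_eq 𝒦 hc hqc, card_zero_eq 𝒦 hd hqd, if_pos rfl, Finset.erase_singleton,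
        Finsupp.single_eq_same]
  | succ n ih =>
    intro q hq c hc hqc
    obtain ⟨hc', p, hpc, hp, hpq⟩ := kflags_erase 𝒦 hq hc hqc
    obtain ⟨z, ⟨hz, hdz⟩, hzc⟩ := ih p hp _ hc' hpc
    have hltq : p < q := by
      refine lt_of_le_of_ne (WithBot.coe_le_coe.1 (𝒦.le_of_mem q _ hpq)) ?_
      rintro rfl; omega
    obtain ⟨w, hw, hwz⟩ := exists_boundary_eq R 𝒦 (q := q) (by omega) n (z := z)
      (supported_sub R hz (fun s hs => ⟨⟨hs.1.1, fun x hx => (hs.2 x hx).trans hltq,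
        fun x hx _ => by have := grade_lt (hs.2 x hx); omega⟩, hs.1.2⟩))
      (LinearMap.mem_ker.1 hdz)
    refine ⟨susp R p z - (-1 : R) ^ n • w, ⟨?_, ?_⟩, ?_⟩
    · refine Submodule.sub_mem _ ?_ (Submodule.smul_mem _ _ ?_)
      · refine supported_map_le R (susp R p) _ (fun s hs => ?_) hz
        rw [susp_single]
        have hps : p ∉ s := fun h => lt_irrefl _ (hs.2 p h)
        refine Finsupp.single_mem_supported R 1 ⟨⟨?_, ?_⟩, ?_⟩
        · rw [Finset.coe_insert]
          exact hs.1.1.insert fun y hy _ => Or.inr (hs.2 y hy).le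
        · rw [Finset.card_insert_of_notMem hps, hs.1.2]
        · intro x hx
          rcases Finset.mem_insert.1 hx with rfl | hx
          · exact hltq
          · exact (hs.2 x hx).trans hltq
      · exact supported_sub R hw (fun s hs => ⟨⟨hs.1.1, hs.2⟩, hs.1.2.1⟩)
    · change boundary R _ = 0
      rw [map_sub, map_smul, hwz,
        boundary_susp R p n (supported_sub R hz (fun s hs => ⟨hs.1.2, hs.2⟩)),
        LinearMap.mem_ker.1 hdz, map_zero, zero_add, sub_self]
    · intro d hd hqd
      obtain ⟨hd', p', hpd', hp', hpq'⟩ := kflags_erase 𝒦 hq hd hqd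
      have hw0 : w (d.erase q) = 0 := by
        refine (Finsupp.mem_supported' R w).1 hw _ fun h => ?_
        have := h.1.2.2 p' hpd' hpq'
        omega
      rw [Finsupp.sub_apply, Finsupp.smul_apply, hw0, smul_zero, sub_zero]
      by_cases hpd : p ∈ d.erase q
      · rw [susp_apply_of_mem R p (supported_sub R hz (fun s hs => hs.2)) _ hpd,
          hzc _ hd' hpd]
        congr 1
        apply propext
        constructor
        · intro h
          rw [← Finset.insert_erase hqd, h, Finset.insert_erase hqc]
        · rintro rfl; rfl
      · rw [susp_apply_of_notMem R p z _ hpd, if_neg]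
        rintro rfl; exact hpd hpc

theorem exists_top {n : ℕ} {c : Finset P} (hc : IsChain (· ≤ ·) (c : Set P))
    (hcard : c.card = n + 1) (hg : ∀ p ∈ c, grade ℕ p < n + 1) : ∃ q ∈ c, grade ℕ q = n :=
  exists_grade_eq hc hg hcard (Nat.lt_succ_self n)

/-- The coordinates of `H_n (F_n C / F_{n-1} C) = ⨁ H_{n-1} (P_{<p})`. On `H_{n-1} (P_{<q})` with
`dim q = n` there is the isomorphism `d_q` to the direct sum of the `H_{n-2} (P_{<p})` over
`p ∈ (K_q)_{n-1}`, whose components are `(-1) ^ n` times truncation at `p`. The basis is the one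
that the `d_q` carry to basis elements, starting with the empty chain for `dim q = 0`. So the
coordinate at `p₀ < ... < pₙ` is found by truncating at `pₙ`, then at `pₙ₋₁`, ..., `p₀` with signs
`(-1) ^ n`, ..., `(-1) ^ 1`: it is `(-1) ^ (n (n + 1) / 2)` times the coefficient of that chain. -/
def LocalCoveringFamily.coord (n : ℕ) : relCycles P R n →ₗ[R] (𝒦.kflags n →₀ R) :=
  ((-1 : R) ^ (n * (n + 1) / 2)) •
    (Finsupp.lsubtypeDomain (R := R) (M := R) (𝒦.kflags n)).comp (relCycles P R n).subtype

theorem coord_apply (n : ℕ) (z : relCycles P R n) (c : 𝒦.kflags n) :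
    𝒦.coord R n z c = (-1 : R) ^ (n * (n + 1) / 2) * (z : Finset P →₀ R) c := rfl

theorem neg_one_pow_mul_self (n : ℕ) : (-1 : R) ^ n * (-1 : R) ^ n = 1 := by
  rw [← mul_pow]; simp

theorem coord_injective (n : ℕ) : Function.Injective (𝒦.coord R n) := by
  classical
  intro a b hab
  obtain ⟨z, hz, hzab⟩ : ∃ z ∈ relCycles P R n, z = (a : Finset P →₀ R) - b :=
    ⟨_, Submodule.sub_mem _ a.2 b.2, rfl⟩
  have hv : ∀ c ∈ 𝒦.kflags n, z c = 0 := by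
    intro c hc
    have h1 := coord_apply R 𝒦 n a ⟨c, hc⟩
    have h2 := coord_apply R 𝒦 n b ⟨c, hc⟩
    rw [hab] at h1
    calc z c = (-1 : R) ^ (n * (n + 1) / 2) * ((-1 : R) ^ (n * (n + 1) / 2) * z c) := by
          rw [← mul_assoc, neg_one_pow_mul_self, one_mul]
      _ = 0 := by rw [hzab, Finsupp.sub_apply, mul_sub, ← h1, ← h2, sub_self, mul_zero]
  have hT : ∀ q : P, grade ℕ q = n → trunc R q z = 0 := fun q hq =>
    eq_zero_of_kflags_below R 𝒦 n q hq _ (trunc_mem R hz hq) fun c hc hqc => by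
      rw [trunc_apply R q z _ (Finset.notMem_erase q c), Finset.insert_erase hqc, hv c hc]
  refine Subtype.ext (sub_eq_zero.1 (hzab ▸ ?_))
  ext s
  by_contra hs
  obtain ⟨h1, h2, h3⟩ := hz.1 (Finsupp.mem_support_iff.2 hs)
  obtain ⟨q, hq, hqn⟩ := exists_top h1 h2 h3
  have h5 := trunc_apply R q z _ (Finset.notMem_erase q s)
  rw [hT q hqn, Finset.insert_erase hq] at h5
  exact hs h5.symm

open Classical in
theorem exists_dual {n : ℕ} {c : Finset P} (hc : c ∈ 𝒦.kflags n) :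
    ∃ z ∈ relCycles P R n, ∀ d ∈ 𝒦.kflags n, z d = if d = c then 1 else 0 := by
  obtain ⟨q, hq, hqn⟩ := exists_top hc.1.1 hc.1.2.1 hc.1.2.2
  obtain ⟨y, hy, hyc⟩ := exists_dual_below R 𝒦 n q hqn c hc hq
  obtain ⟨hy1, hy2⟩ := Submodule.mem_inf.1 hy
  rw [LinearMap.mem_ker] at hy2
  refine ⟨susp R q y, Submodule.mem_inf.2 ⟨?_, ?_⟩, fun d hd => ?_⟩
  · refine supported_map_le R (susp R q) _ (fun s hs => ?_) hy1
    rw [susp_single]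
    have hqs : q ∉ s := fun h => lt_irrefl _ (hs.2 q h)
    refine Finsupp.single_mem_supported R 1 ⟨?_, ?_, ?_⟩
    · rw [Finset.coe_insert]
      exact hs.1.1.insert fun y hy _ => Or.inr (hs.2 y hy).le
    · rw [Finset.card_insert_of_notMem hqs, hs.1.2]
    · intro x hx
      rcases Finset.mem_insert.1 hx with rfl | hx
      · omega
      · have := grade_lt (hs.2 x hx); omega
  · rw [Submodule.mem_comap,
      boundary_susp R q n (supported_sub R hy1 (fun s hs => ⟨hs.1.2, hs.2⟩)), hy2, map_zero,
      zero_add]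
    refine Submodule.smul_mem _ _ (supported_sub R hy1 (fun s hs => ⟨hs.1.1, hs.1.2, ?_⟩))
    intro x hx
    have := grade_lt (hs.2 x hx); omega
  · by_cases hqd : q ∈ d
    · rw [susp_apply_of_mem R q (supported_sub R hy1 (fun s hs => hs.2)) _ hqd, hyc d hd hqd]
    · rw [susp_apply_of_notMem R q y _ hqd, if_neg]
      rintro rfl; exact hqd hq

theorem coord_surjective (n : ℕ) : Function.Surjective (𝒦.coord R n) := by
  classical
  intro f
  induction f using Finsupp.induction_linear with
  | zero => exact ⟨0, map_zero _⟩
  | add f g hf hg =>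
    obtain ⟨a, rfl⟩ := hf
    obtain ⟨b, rfl⟩ := hg
    exact ⟨a + b, map_add _ _ _⟩
  | single c a =>
    obtain ⟨z, hz, hzc⟩ := exists_dual R 𝒦 c.2
    refine ⟨((-1 : R) ^ (n * (n + 1) / 2) * a) • ⟨z, hz⟩, ?_⟩
    ext d
    rw [coord_apply, Submodule.coe_smul, Finsupp.smul_apply, hzc d d.2, smul_eq_mul,
      ← mul_assoc, ← mul_assoc, neg_one_pow_mul_self, one_mul, Finsupp.single_apply]
    by_cases h : d = c
    · rw [h, if_pos rfl, if_pos rfl, mul_one]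
    · rw [if_neg (fun h' => h (Subtype.ext h')), if_neg (Ne.symm h), mul_zero]

/-- The coordinates as an isomorphism. -/
def LocalCoveringFamily.coordEquiv (n : ℕ) : relCycles P R n ≃ₗ[R] (𝒦.kflags n →₀ R) :=
  LinearEquiv.ofBijective (𝒦.coord R n) ⟨coord_injective R 𝒦 n, coord_surjective R 𝒦 n⟩

variable (P) in
theorem boundary_mem_relCycles (n : ℕ) {z : Finset P →₀ R} (hz : z ∈ relCycles P R (n + 1)) :
    boundary R z ∈ relCycles P R n := by
  obtain ⟨h1, h2⟩ := Submodule.mem_inf.1 hz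
  refine Submodule.mem_inf.2 ⟨h2, ?_⟩
  rw [Submodule.mem_comap, boundary_boundary R (supported_sub R h1 (fun s hs => hs.1))]
  exact Submodule.zero_mem _

variable (P) in
/-- The differential `H_n (F_n C / F_{n-1} C) → H_{n-1} (F_{n-1} C / F_{n-2} C)` induced by `∂`
(with `n + 1` in place of `n`). -/
def relBoundary (n : ℕ) : relCycles P R (n + 1) →ₗ[R] relCycles P R n :=
  (boundary R).restrict fun _ hz => boundary_mem_relCycles P R n hz

/-- The differential `relBoundary`, written in coordinates. -/
def LocalCoveringFamily.d (n : ℕ) : (𝒦.kflags (n + 1) →₀ R) →ₗ[R] (𝒦.kflags n →₀ R) :=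
  (𝒦.coordEquiv R n).toLinearMap ∘ₗ relBoundary P R n ∘ₗ (𝒦.coordEquiv R (n + 1)).symm.toLinearMap

theorem d_comp_d (n : ℕ) : 𝒦.d R n ∘ₗ 𝒦.d R (n + 1) = 0 := by
  refine LinearMap.ext fun f => ?_
  simp only [LocalCoveringFamily.d, LinearMap.comp_apply, LinearEquiv.coe_coe,
    LinearEquiv.symm_apply_apply, LinearMap.zero_apply, LinearEquiv.map_eq_zero_iff]
  refine Subtype.ext ?_
  have hz := ((𝒦.coordEquiv R (n + 1 + 1)).symm f).2
  exact boundary_boundary R (supported_sub R (Submodule.mem_inf.1 hz).1 (fun s hs => hs.1))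

end Complex

section

universe u v

open CategoryTheory

variable {P : Type u} [PartialOrder P] [GradeMinOrder ℕ P]

/-- The chain complex `C^K_* (P; R)` of a graded poset with a local covering family: in degree `n`
it is the direct sum of the modules `R ^ (K^p_n)` over all `p` of dimension `n`. -/
def LocalCoveringFamily.complex (𝒦 : LocalCoveringFamily P) (R : Type v) [CommRing R] :
    ChainComplex (ModuleCat.{max u v} R) ℕ :=
  ChainComplex.of (fun n => ModuleCat.of R (𝒦.kflags n →₀ R)) (fun n => ModuleCat.ofHom (𝒦.d R n))
    (fun n => by rw [← ModuleCat.ofHom_comp, d_comp_d]; rfl)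

section Simplicial

variable {V : Type u} [LinearOrder V] (Δ : PreAbstractSimplicialComplex V)

/-- The face poset: nonempty simplices, ordered by inclusion. -/
abbrev FacePoset : Type u := {σ : Finset V // σ ∈ Δ.faces}

variable {Δ}

theorem FacePoset.nonempty (σ : FacePoset Δ) : σ.1.Nonempty := (Δ.isRelLowerSet_faces σ.2).1

/-- A nonempty subset of a simplex. -/
def FacePoset.face (σ : FacePoset Δ) (t : Finset V) (h : t ⊆ σ.1) (ht : t.Nonempty) :
    FacePoset Δ :=
  ⟨t, (Δ.isRelLowerSet_faces σ.2).2 h ht⟩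

/-- The grading of the face poset by simplicial dimension. -/
instance : GradeMinOrder ℕ (FacePoset Δ) where
  grade σ := σ.1.card - 1
  grade_strictMono σ τ h := by
    have h1 := Finset.card_lt_card (show σ.1 ⊂ τ.1 from h)
    have h2 := Finset.card_pos.2 σ.nonempty
    dsimp only
    omega
  covBy_grade σ τ h := by
    have h1 : σ.1 ⊂ τ.1 := h.1
    obtain ⟨v, hv, hvσ⟩ := Finset.exists_of_ssubset h1
    have hsub : insert v σ.1 ⊆ τ.1 := Finset.insert_subset hv h1.subset
    have h2 : ¬ insert v σ.1 ⊂ τ.1 := fun h' =>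
      h.2 (c := τ.face (insert v σ.1) hsub (Finset.insert_nonempty _ _))
        (show σ.1 ⊂ insert v σ.1 from Finset.ssubset_insert hvσ) h'
    have h3 : insert v σ.1 = τ.1 := by
      by_contra hne
      exact h2 (lt_of_le_of_ne hsub hne)
    have h4 := Finset.card_pos.2 σ.nonempty
    rw [Nat.covBy_iff_add_one_eq, ← h3, Finset.card_insert_of_notMem hvσ]
    omega
  isMin_grade σ h := by
    obtain ⟨v, hv⟩ := σ.nonempty
    have h1 : σ.1 ⊆ {v} := h (b := σ.face {v} (by simpa using hv) (by simp))
      (show ({v} : Finset V) ⊆ σ.1 by simpa using hv)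
    have h2 := Finset.card_le_card h1
    rw [Finset.card_singleton] at h2
    rw [isMin_iff_eq_bot]
    exact Nat.sub_eq_zero_of_le h2

/-- The vertices of a simplex; `⊥` is the empty simplex. -/
def FacePoset.vertices : WithBot (FacePoset Δ) → Finset V
  | ⊥ => ∅
  | (σ : FacePoset Δ) => σ.1

theorem FacePoset.vertices_mono {x y : WithBot (FacePoset Δ)} :
    FacePoset.vertices x ⊆ FacePoset.vertices y ↔ x ≤ y := by
  induction x using WithBot.recBotCoe with
  | bot => simp [FacePoset.vertices]
  | coe σ =>
    induction y using WithBot.recBotCoe with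
    | bot =>
      simp only [FacePoset.vertices, Finset.subset_empty, le_bot_iff, WithBot.coe_ne_bot, iff_false]
      exact σ.nonempty.ne_empty
    | coe τ => rw [WithBot.coe_le_coe]; rfl

theorem FacePoset.dim_eq (x : WithBot (FacePoset Δ)) :
    dim x = (FacePoset.vertices x).card - 1 := by
  induction x using WithBot.recBotCoe with
  | bot => rfl
  | coe σ =>
    have h := Finset.card_pos.2 σ.nonempty
    have h1 : dim (σ : WithBot (FacePoset Δ)) = ((σ.1.card - 1 : ℕ) : ℤ) := rfl
    rw [h1]
    simp only [FacePoset.vertices]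
    omega

/-- The least vertex `σ^*` of `σ`. -/
def FacePoset.star (σ : FacePoset Δ) : V := σ.1.min' σ.nonempty

theorem FacePoset.star_mem (σ : FacePoset Δ) : σ.star ∈ σ.1 := σ.1.min'_mem _

variable (Δ) in
/-- The local covering family `K_Δ` of the face poset given by a total order of the vertices:
`K_σ` consists of the `τ ⊆ σ` with `σ^* ∉ τ`, and `η_σ τ = τ ∪ {σ^*}`. -/
def coveringFamily : LocalCoveringFamily (FacePoset Δ) where
  K σ := {τ | τ ≤ σ ∧ σ.star ∉ FacePoset.vertices τ}
  le_of_mem σ τ h := h.1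
  η σ τ := ((σ.face (insert σ.star (FacePoset.vertices τ.1))
    (Finset.insert_subset σ.star_mem (FacePoset.vertices_mono.2 τ.2.1))
    (Finset.insert_nonempty _ _) : FacePoset Δ) : WithBot (FacePoset Δ))
  η_le σ τ := WithBot.coe_le_coe.2
    (Finset.insert_subset σ.star_mem (FacePoset.vertices_mono.2 τ.2.1))
  η_notMem σ τ h := h.2 (Finset.mem_insert_self _ _)
  bot_mem σ := ⟨bot_le, Finset.notMem_empty _⟩
  lt_η σ τ := by
    refine lt_of_le_not_ge (FacePoset.vertices_mono.1 (Finset.subset_insert _ _)) fun h => ?_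
    exact τ.2.2 (FacePoset.vertices_mono.2 h (Finset.mem_insert_self _ _))
  dim_η σ τ := by
    rw [FacePoset.dim_eq, FacePoset.dim_eq]
    change (((insert σ.star (FacePoset.vertices τ.1)).card : ℤ) - 1) = _
    rw [Finset.card_insert_of_notMem τ.2.2]
    push_cast; ring
  η_bot σ τ hle h := by
    have hmem : σ.star ∈ τ.1 := by
      by_contra h'
      exact h ⟨WithBot.coe_le_coe.2 hle, h'⟩
    have : σ.star = τ.star := le_antisymm
      (Finset.min'_le _ _ (hle τ.star_mem)) (Finset.min'_le _ _ hmem)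
    simp only [this, FacePoset.face]
  η_mono σ x y h := WithBot.coe_le_coe.2
    (Finset.insert_subset_insert _ (FacePoset.vertices_mono.2 h))
  η_le_of_notMem σ x r hr hxr hrσ := by
    refine FacePoset.vertices_mono.1 (Finset.insert_subset ?_ (FacePoset.vertices_mono.2 hxr))
    by_contra h
    exact hr ⟨hrσ, h⟩

variable (Δ) in
/-- Simplicial `n`-chains: the free module on the `n`-simplices. -/
def simplicialChains (R : Type v) [CommRing R] (n : ℕ) : Submodule R (Finset V →₀ R) :=
  Finsupp.supported R R {s : Finset V | s ∈ Δ.faces ∧ s.card = n + 1}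

variable (Δ) in
theorem boundary_mem_simplicialChains (R : Type v) [CommRing R] (n : ℕ) {z : Finset V →₀ R}
    (hz : z ∈ simplicialChains Δ R (n + 1)) : boundary R z ∈ simplicialChains Δ R n := by
  refine supported_map_le R (boundary R) _ (fun s hs => ?_) hz
  refine supported_sub R (boundary_single_mem R s 1) fun t ht => ?_
  have hc : t.card + 1 = n + 1 + 1 := ht.2.trans hs.2
  exact ⟨(Δ.isRelLowerSet_faces hs.1).2 ht.1 (Finset.card_pos.1 (by omega)), by omega⟩

variable (Δ) in
/-- The simplicial chain complex of `Δ`, with simplices oriented by the order of the vertices: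
`∂ {v₀ < ... < vₙ} = ∑ i, (-1) ^ i {v₀, ..., vₙ} ∖ {vᵢ}`. -/
def simplicialChainComplex (R : Type v) [CommRing R] :
    ChainComplex (ModuleCat.{max u v} R) ℕ :=
  ChainComplex.of (fun n => ModuleCat.of R (simplicialChains Δ R n))
    (fun n => ModuleCat.ofHom
      ((boundary R).restrict fun _ hz => boundary_mem_simplicialChains Δ R n hz))
    (fun n => by
      rw [← ModuleCat.ofHom_comp]
      have h : ((boundary R).restrict fun _ hz => boundary_mem_simplicialChains Δ R n hz) ∘ₗ
          ((boundary R).restrict fun _ hz => boundary_mem_simplicialChains Δ R (n + 1) hz) =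
            (0 : simplicialChains Δ R (n + 1 + 1) →ₗ[R] simplicialChains Δ R n) := by
        refine LinearMap.ext fun z => Subtype.ext ?_
        exact boundary_boundary R
          (supported_sub R z.2 fun s _ => fun x _ y _ _ => le_total x y)
      rw [h]; rfl)

end Simplicial

end

end LocalCovering
end

noncomputable section

namespace LocalCovering

open Finset CategoryTheory

universe u v

section DecidableEq

/-! The facts that mention `insert` and `erase`, for an arbitrary decidable equality. -/

variable {P : Type u} [PartialOrder P] (R : Type v) [CommRing R] [DecidableEq P]

/-! For the family `coveringFamily Δ` the only element of dimension `dim σ - 1` in `K_σ` is `σ ∖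
{σ^*}` (for `dim σ > 0`). A basis flag is therefore determined by its largest member: going down,
each step deletes the least vertex. Conversely every simplex heads such a flag, so the basis flags
in degree `n` correspond to the `n`-simplices (`topSimplex_bijective`), and the two complexes have
matching free modules.

The differentials match because the dimension filtration is the skeletal filtration of the
barycentric subdivision. Subdividing an `n`-simplex gives a chain of flags with `n + 1` members,
none of dimension above `n`, whose boundary is the subdivision of the simplicial boundary and so
lies one step lower in the filtration. Thus `subdivision` maps simplicial chains to relative cycles
(`subdivision_mem_relCycles`) and commutes with the boundary (`boundary_subdivision`).

It remains to read off coordinates. The subdivision of `σ` is, up to sign, the cone with apex `σ`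
over the subdivided faces of `σ`. At a flag headed by `σ` only the face `σ ∖ {σ^*}` contributes, and
it enters the boundary with sign `+1`, since `σ^*` is the first vertex. By induction the coefficient
is the product of the cone signs, `(-1) ^ (n (n + 1) / 2)` (`subdivision_single_apply`), which is
exactly the sign built into `coord`. In coordinates subdivision is then the bijection of bases
(`coord_subdivision`). As `coordEquiv` is already known to be an isomorphism, the differential `d`
becomes the simplicial one. -/

theorem boundary_single_of_decidableEq (s : Finset P) (a : R) :
    boundary R (Finsupp.single s a)
      = ∑ x ∈ s, Finsupp.single (s.erase x) (a * sgn R s x) := by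
  convert boundary_single R s a

theorem susp_single_of_decidableEq (q : P) (s : Finset P) (a : R) :
    susp R q (Finsupp.single s a) = Finsupp.single (insert q s) a := by
  convert susp_single R q s a

theorem susp_apply_eq_erase (q : P) {z : Finset P →₀ R}
    (hz : z ∈ Finsupp.supported R R {s : Finset P | ∀ x ∈ s, x < q})
    (s : Finset P) (hs : q ∈ s) : susp R q z s = z (s.erase q) := by
  convert susp_apply_of_mem R q hz s hs

theorem sgn_eq_one_of_forall {s : Finset P} {x : P} (h : ∀ y ∈ s, ¬ y < x) : sgn R s x = 1 := by
  classical
  unfold sgn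
  rw [Finset.filter_false_of_mem h, Finset.card_empty, pow_zero]

variable [GradeMinOrder ℕ P] (𝒦 : LocalCoveringFamily P)

theorem kflags_insert_mem {n : ℕ} {p q : P} (hp : grade ℕ p = n)
    (hpq : (p : WithBot P) ∈ 𝒦.K q) (hq : grade ℕ q = n + 1) {c : Finset P}
    (hc : c ∈ 𝒦.kflags n) (hpc : p ∈ c) : insert q c ∈ 𝒦.kflags (n + 1) := by
  convert (kflags_insert 𝒦 hp hpq hq hc hpc).1

theorem kflags_erase_mem {n : ℕ} {q : P} (hq : grade ℕ q = n + 1) {c : Finset P}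
    (hc : c ∈ 𝒦.kflags (n + 1)) (hqc : q ∈ c) :
    c.erase q ∈ 𝒦.kflags n ∧
      ∃ p ∈ c.erase q, grade ℕ p = n ∧ (p : WithBot P) ∈ 𝒦.K q := by
  convert kflags_erase 𝒦 hq hc hqc

end DecidableEq

/-! ### Barycentric subdivision as a chain map -/

variable {V : Type u} [LinearOrder V] (Δ : PreAbstractSimplicialComplex V)
  (R : Type v) [CommRing R]

open Classical in
/-- Barycentric subdivision of chains on `k` vertices, into flags with `k` members: the subdivision
of a simplex is, up to sign, the cone over the subdivision of its boundary. -/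
def subdivision : ℕ → (Finset V →₀ R) →ₗ[R] (Finset (FacePoset Δ) →₀ R)
  -- Only the value at `∅` is meaningful: the empty simplex goes to the empty flag, the generator of
  -- `C_{-1}`. This case stands apart because `∅` is not in `Δ.faces`.
  | 0 => Finsupp.linearCombination R fun _ => Finsupp.single ∅ 1
  | k + 1 => Finsupp.linearCombination R fun s =>
      if h : s ∈ Δ.faces then
        -- The apex is the last member of the flag, above `k` others, so deleting it costs `(-1) ^
        -- k` in `boundary_susp`; the factor here cancels that sign.
        (-1 : R) ^ k • susp R (⟨s, h⟩ : FacePoset Δ)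
          (subdivision k (boundary R (Finsupp.single s 1)))
      else 0

theorem subdivision_zero_single (s : Finset V) (a : R) :
    subdivision Δ R 0 (Finsupp.single s a) = Finsupp.single ∅ a := by
  simp [subdivision]

theorem subdivision_succ_single_one (k : ℕ) {s : Finset V} (h : s ∈ Δ.faces) :
    subdivision Δ R (k + 1) (Finsupp.single s 1) =
      (-1 : R) ^ k • susp R (⟨s, h⟩ : FacePoset Δ)
        (subdivision Δ R k (boundary R (Finsupp.single s 1))) := by
  simp [subdivision, h]

/-- The flags with `k` members, all of them properly contained in `s`. -/
def flagsBelow (k : ℕ) (s : Finset V) : Set (Finset (FacePoset Δ)) :=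
  {c | (IsChain (· ≤ ·) (c : Set (FacePoset Δ)) ∧ c.card = k) ∧ ∀ x ∈ c, x.1 ⊂ s}

theorem subdivision_single_mem (k : ℕ) : ∀ s : Finset V, s.card = k →
    subdivision Δ R k (Finsupp.single s 1) ∈ Finsupp.supported R R
      {c : Finset (FacePoset Δ) | (IsChain (· ≤ ·) (c : Set (FacePoset Δ)) ∧ c.card = k) ∧
        ∀ x ∈ c, x.1 ⊆ s} := by
  induction k with
  | zero =>
    intro s _
    rw [subdivision_zero_single]
    exact Finsupp.single_mem_supported R 1 (by simp)
  | succ k ih =>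
    intro s hs
    by_cases h : s ∈ Δ.faces
    · rw [subdivision_succ_single_one Δ R k h]
      -- The facets of `s` are proper subsets, so the flags in their subdivisions stay strictly
      -- below `s` and `s` can be put on top.
      have hb : subdivision Δ R k (boundary R (Finsupp.single s 1)) ∈
          Finsupp.supported R R (flagsBelow Δ k s) := by
        refine supported_map_le R (subdivision Δ R k) _ (fun t ht => ?_)
          (boundary_single_mem R s 1)
        have hc : t.card + 1 = s.card := ht.2
        refine supported_sub R (ih t (by omega)) fun c hc' => ⟨hc'.1, fun x hx => ?_⟩
        refine (hc'.2 x hx).trans_ssubset (ht.1.ssubset_of_ne ?_)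
        rintro rfl
        omega
      refine Submodule.smul_mem _ _ (supported_map_le R (susp R _) _ (fun c hc => ?_) hb)
      rw [susp_single_of_decidableEq]
      have hsc : (⟨s, h⟩ : FacePoset Δ) ∉ c := fun h' => (hc.2 _ h').ne rfl
      refine Finsupp.single_mem_supported R 1 ⟨⟨?_, ?_⟩, fun x hx => ?_⟩
      · rw [Finset.coe_insert]
        exact hc.1.1.insert fun y hy _ => Or.inr (hc.2 y hy).subset
      · rw [Finset.card_insert_of_notMem hsc, hc.1.2]
      · rcases Finset.mem_insert.1 hx with rfl | hx
        · exact Finset.Subset.refl s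
        · exact (hc.2 x hx).subset
    · simp [subdivision, h]

/-- This puts the base of the cone strictly below its apex, as `boundary_susp` and
`susp_apply_eq_erase` require. -/
theorem subdivision_boundary_mem (k : ℕ) {s : Finset V} (hs : s.card = k + 1) :
    subdivision Δ R k (boundary R (Finsupp.single s 1)) ∈
      Finsupp.supported R R (flagsBelow Δ k s) := by
  refine supported_map_le R (subdivision Δ R k) _ (fun t ht => ?_) (boundary_single_mem R s 1)
  have hc : t.card + 1 = s.card := ht.2
  refine supported_sub R (subdivision_single_mem Δ R k t (by omega)) fun c hc' =>
    ⟨hc'.1, fun x hx => (hc'.2 x hx).trans_ssubset (ht.1.ssubset_of_ne ?_)⟩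
  rintro rfl
  omega

/-- The boundary of a cone over a cycle is that cycle, up to the sign cancelled in the definition.
The base is a cycle by induction, since the simplicial boundary squares to zero. -/
theorem boundary_subdivision_single (k : ℕ) : ∀ s ∈ Δ.faces, s.card = k + 1 →
    boundary R (subdivision Δ R (k + 1) (Finsupp.single s 1)) =
      subdivision Δ R k (boundary R (Finsupp.single s 1)) := by
  induction k with
  | zero =>
    intro s h hs
    have hb := boundary_susp R (⟨s, h⟩ : FacePoset Δ) 0 (supported_sub R
      (subdivision_boundary_mem Δ R 0 hs) fun c hc => ⟨hc.1.2, fun x hx => hc.2 x hx⟩)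
    -- The facet of a vertex is the empty simplex, to which no induction hypothesis applies; its
    -- subdivision is the empty flag, whose boundary is an empty sum.
    have h0 : boundary R (subdivision Δ R 0 (boundary R (Finsupp.single s 1))) = 0 := by
      obtain ⟨v, rfl⟩ := Finset.card_eq_one.1 hs
      simp [boundary_single_of_decidableEq, subdivision_zero_single]
    rw [subdivision_succ_single_one Δ R 0 h, map_smul, hb, h0]
    simp
  | succ k ih =>
    intro s h hs
    have hb := boundary_susp R (⟨s, h⟩ : FacePoset Δ) (k + 1) (supported_sub R
      (subdivision_boundary_mem Δ R (k + 1) hs) fun c hc => ⟨hc.1.2, fun x hx => hc.2 x hx⟩)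
    have h0 : boundary R (subdivision Δ R (k + 1) (boundary R (Finsupp.single s 1))) = 0 := by
      have h1 := supported_induction R ((boundary R).comp (subdivision Δ R (k + 1)))
        ((subdivision Δ R k).comp (boundary R)) (fun t ht => ?_) (boundary_single_mem R s 1)
      · simp only [LinearMap.comp_apply] at h1
        rw [h1, boundary_boundary_single R s (fun x _ y _ _ => le_total x y), map_zero]
      · have hc : t.card + 1 = s.card := ht.2
        exact ih t ((Δ.isRelLowerSet_faces h).2 ht.1 (Finset.card_pos.1 (by omega))) (by omega)
    rw [subdivision_succ_single_one Δ R (k + 1) h, map_smul, hb, h0, map_zero, zero_add, smul_smul,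
      neg_one_pow_mul_self, one_smul]

/-- For `n = 0` this is compatibility with the augmentations. -/
theorem boundary_subdivision (n : ℕ) {z : Finset V →₀ R} (hz : z ∈ simplicialChains Δ R n) :
    boundary R (subdivision Δ R (n + 1) z) = subdivision Δ R n (boundary R z) :=
  supported_induction R ((boundary R).comp (subdivision Δ R (n + 1)))
    ((subdivision Δ R n).comp (boundary R))
    (fun s hs => boundary_subdivision_single Δ R n s hs.1 hs.2) hz

/-! ### Subdivided chains as relative cycles -/

variable {Δ} in
theorem FacePoset.grade_eq (σ : FacePoset Δ) : grade ℕ σ + 1 = σ.1.card :=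
  Nat.sub_add_cancel (Finset.card_pos.2 σ.nonempty)

/-- All members of the flags are subsets of a set with `k` elements, hence of dimension at most `k -
1`. Only cardinality is assumed, not membership in `Δ.faces`, so that the case `k = 0` covers the
augmentation of a `0`-chain, which is supported on `∅`. -/
theorem subdivision_mem_filtration (k : ℕ) {z : Finset V →₀ R}
    (hz : z ∈ Finsupp.supported R R {s : Finset V | s.card = k}) :
    subdivision Δ R k z ∈ filtration (FacePoset Δ) R k k := by
  refine supported_map_le R (subdivision Δ R k) _ (fun s hs => ?_) hz
  have hs : s.card = k := hs
  refine supported_sub R (subdivision_single_mem Δ R k s hs) fun c hc =>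
    ⟨hc.1.1, hc.1.2, fun x hx => ?_⟩
  have h1 := Finset.card_le_card (hc.2 x hx)
  have h2 := x.grade_eq
  omega

theorem subdivision_mem_relCycles (n : ℕ) {z : Finset V →₀ R}
    (hz : z ∈ simplicialChains Δ R n) :
    subdivision Δ R (n + 1) z ∈ relCycles (FacePoset Δ) R n := by
  refine Submodule.mem_inf.2 ⟨subdivision_mem_filtration Δ R _
    (supported_sub R hz fun s hs => hs.2), ?_⟩
  rw [Submodule.mem_comap, boundary_subdivision Δ R n hz]
  refine subdivision_mem_filtration Δ R _
    (supported_map_le R (boundary R) _ (fun s hs => ?_) hz)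
  refine supported_sub R (boundary_single_mem R s 1) fun t ht => ?_
  have hc : t.card + 1 = n + 1 := ht.2.trans hs.2
  exact Nat.succ.inj hc

/-! ### Coefficients of subdivided simplices at basis flags -/

variable {Δ} in
-- Membership in `K_σ` means `τ ⊆ σ ∖ {σ^*}`, and the two sets have the same size. This rigidity
-- makes every rank number of the family equal to one.
theorem FacePoset.eq_erase_star {σ τ : FacePoset Δ} (h : grade ℕ σ = grade ℕ τ + 1)
    (hτ : (τ : WithBot (FacePoset Δ)) ∈ (coveringFamily Δ).K σ) : τ.1 = σ.1.erase σ.star := by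
  have hle : τ ≤ σ := WithBot.coe_le_coe.1 hτ.1
  have hle : τ.1 ⊆ σ.1 := hle
  refine Finset.eq_of_subset_of_card_le (fun x hx => Finset.mem_erase.2 ⟨?_, hle hx⟩) ?_
  · rintro rfl
    exact hτ.2 hx
  · rw [Finset.card_erase_of_mem σ.star_mem, ← σ.grade_eq, ← τ.grade_eq]
    omega

theorem sgn_star (σ : FacePoset Δ) : sgn R σ.1 σ.star = 1 :=
  sgn_eq_one_of_forall R fun x hx => not_lt.2 (Finset.min'_le _ x hx)

/-- The coefficients of a subdivided simplex at the basis flags. -/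
theorem subdivision_single_apply (n : ℕ) : ∀ σ : FacePoset Δ, grade ℕ σ = n →
    ∀ c ∈ (coveringFamily Δ).kflags n,
      subdivision Δ R (n + 1) (Finsupp.single σ.1 1) c =
        if σ ∈ c then (-1 : R) ^ (n * (n + 1) / 2) else 0 := by
  induction n with
  | zero =>
    intro σ hσ c hc
    have hcard : σ.1.card = 1 := by rw [← σ.grade_eq, hσ]
    obtain ⟨v, hv⟩ := Finset.card_eq_one.1 hcard
    -- For a vertex, the cone over the empty flag is the flag `{σ}`, with sign `+1`.
    rw [subdivision_succ_single_one Δ R 0 σ.2]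
    by_cases h : σ ∈ c
    · have hb : boundary R (Finsupp.single σ.1 1) = Finsupp.single ∅ 1 := by
        rw [hv, boundary_single_of_decidableEq, Finset.sum_singleton, Finset.erase_singleton,
          sgn_eq_one_of_forall R (by simp), one_mul]
      rw [hb, subdivision_zero_single, susp_single_of_decidableEq, card_zero_eq _ hc h,
        if_pos (Finset.mem_singleton_self σ)]
      simp
    · rw [Finsupp.smul_apply, susp_apply_of_notMem R _ _ c h, if_neg h, smul_zero]
  | succ n ih =>
    intro σ hσ c hc
    have hcard : σ.1.card = n + 1 + 1 := by rw [← σ.grade_eq, hσ]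
    rw [subdivision_succ_single_one Δ R (n + 1) σ.2, Finsupp.smul_apply]
    by_cases h : σ ∈ c
    · obtain ⟨hc', τ, hτ, hτn, hτK⟩ := kflags_erase_mem _ hσ hc h
      -- Below `σ` the flag continues with `σ ∖ {σ^*}`, so among the facets of `σ` only the one
      -- omitting `σ^*` can contribute at `c.erase σ`.
      have hτσ := FacePoset.eq_erase_star (by omega) hτK
      rw [susp_apply_eq_erase R σ (supported_sub R (subdivision_boundary_mem Δ R (n + 1) hcard)
        fun d hd x hx => hd.2 x hx) c h, if_pos h, boundary_single_of_decidableEq, map_sum,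
        Finsupp.finsetSum_apply, Finset.sum_eq_single σ.star]
      · rw [one_mul, sgn_star, ← hτσ, ih τ hτn _ hc', if_pos hτ, smul_eq_mul, ← pow_add]
        congr 1
        -- The cone sign `(-1) ^ (n + 1)` raises the triangular number `n (n + 1) / 2` to the next
        -- one.
        have : (n + 1) * (n + 1 + 1) = n * (n + 1) + (n + 1) * 2 := by ring
        rw [this, Nat.add_mul_div_right _ _ two_pos, add_comm]
      · intro x hx hxs
        have hx1 : (σ.1.erase x).card = n + 1 := by
          rw [Finset.card_erase_of_mem hx, hcard]; rfl
        have hne : (σ.1.erase x).Nonempty := Finset.card_pos.1 (by omega)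
        set ρ : FacePoset Δ := σ.face _ (Finset.erase_subset x σ.1) hne with hρ
        have hρn : grade ℕ ρ = n := by
          have := ρ.grade_eq
          have h' : ρ.1.card = n + 1 := hx1
          omega
        -- The incidence sign is pulled out so that the induction hypothesis, stated for coefficient
        -- `1`, applies to the facet `ρ`.
        rw [one_mul, ← mul_one (sgn R σ.1 x), ← smul_eq_mul, ← Finsupp.smul_single, map_smul,
          Finsupp.smul_apply]
        have hi := ih ρ hρn _ hc'
        rw [if_neg] at hi
        · change _ • subdivision Δ R (n + 1) (Finsupp.single ρ.1 1) _ = 0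
          rw [hi, smul_zero]
        · intro hρc
          -- A chain has at most one member of each dimension, so `ρ` would be `σ ∖ {σ^*}`, forcing
          -- `x = σ^*`.
          have he : ρ = τ := grade_injOn hc'.1.1 hρc hτ (hρn.trans hτn.symm)
          have he' : σ.1.erase x = σ.1.erase σ.star := (congrArg Subtype.val he).trans hτσ
          exact hxs (Finset.erase_injOn σ.1 hx σ.star_mem he')
      · intro h'
        exact absurd σ.star_mem h'
    · rw [susp_apply_of_notMem R _ _ c h, if_neg h, smul_zero]

/-! ### Basis flags correspond to simplices -/

theorem exists_kflag (n : ℕ) : ∀ σ : FacePoset Δ, grade ℕ σ = n →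
    ∃ c ∈ (coveringFamily Δ).kflags n, σ ∈ c := by
  induction n with
  | zero => exact fun σ hσ => ⟨{σ}, singleton_mem_kflags _ hσ, Finset.mem_singleton_self σ⟩
  | succ n ih =>
    intro σ hσ
    have hcard : σ.1.card = n + 1 + 1 := by rw [← σ.grade_eq, hσ]
    have hc1 : (σ.1.erase σ.star).card = n + 1 := by
      rw [Finset.card_erase_of_mem σ.star_mem, hcard]; rfl
    obtain ⟨τ, hτ⟩ : ∃ τ : FacePoset Δ, τ.1 = σ.1.erase σ.star :=
      ⟨σ.face _ (Finset.erase_subset _ _) (Finset.card_pos.1 (by omega)), rfl⟩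
    have hτn : grade ℕ τ = n := by
      have := τ.grade_eq
      rw [hτ] at this
      omega
    obtain ⟨c, hc, hτc⟩ := ih τ hτn
    have hK : (τ : WithBot (FacePoset Δ)) ∈ (coveringFamily Δ).K σ := by
      refine ⟨WithBot.coe_le_coe.2 (show τ.1 ⊆ σ.1 from hτ ▸ Finset.erase_subset _ _), ?_⟩
      change σ.star ∉ τ.1
      rw [hτ]
      exact Finset.notMem_erase _ _
    exact ⟨_, kflags_insert_mem _ hτn hK hσ hc hτc, Finset.mem_insert_self _ _⟩

/-- By `FacePoset.eq_erase_star` the member following `σ` downwards is forced, and the rest of the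
flag is settled by induction. -/
theorem kflag_unique (n : ℕ) : ∀ σ : FacePoset Δ, grade ℕ σ = n →
    ∀ c ∈ (coveringFamily Δ).kflags n, ∀ d ∈ (coveringFamily Δ).kflags n,
      σ ∈ c → σ ∈ d → c = d := by
  induction n with
  | zero =>
    intro σ _ c hc d hd hσc hσd
    rw [card_zero_eq _ hc hσc, card_zero_eq _ hd hσd]
  | succ n ih =>
    intro σ hσ c hc d hd hσc hσd
    obtain ⟨hc', τ, hτ, hτn, hτK⟩ := kflags_erase_mem _ hσ hc hσc
    obtain ⟨hd', ρ, hρ, hρn, hρK⟩ := kflags_erase_mem _ hσ hd hσd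
    have he : τ = ρ := Subtype.ext ((FacePoset.eq_erase_star (by omega) hτK).trans
      (FacePoset.eq_erase_star (by omega) hρK).symm)
    rw [← Finset.insert_erase hσc, ih τ hτn _ hc' _ hd' hτ (he ▸ hρ), Finset.insert_erase hσd]

theorem exists_simplex_mem_kflag {n : ℕ} {c : Finset (FacePoset Δ)}
    (hc : c ∈ (coveringFamily Δ).kflags n) :
    ∃ s : {s : Finset V // s ∈ Δ.faces ∧ s.card = n + 1}, (⟨s.1, s.2.1⟩ : FacePoset Δ) ∈ c := by
  obtain ⟨σ, hσ, hσn⟩ := exists_top hc.1.1 hc.1.2.1 hc.1.2.2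
  exact ⟨⟨σ.1, σ.2, by rw [← σ.grade_eq, hσn]⟩, hσ⟩

/-- The largest member of a basis flag. -/
def topSimplex (n : ℕ) (c : (coveringFamily Δ).kflags n) :
    {s : Finset V | s ∈ Δ.faces ∧ s.card = n + 1} :=
  (exists_simplex_mem_kflag Δ c.2).choose

theorem topSimplex_mem (n : ℕ) (c : (coveringFamily Δ).kflags n) :
    (⟨(topSimplex Δ n c).1, (topSimplex Δ n c).2.1⟩ : FacePoset Δ) ∈ c.1 :=
  (exists_simplex_mem_kflag Δ c.2).choose_spec

theorem grade_of_card {n : ℕ} {s : Finset V} (hs : s ∈ Δ.faces) (hc : s.card = n + 1) :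
    grade ℕ (⟨s, hs⟩ : FacePoset Δ) = n := by
  have := FacePoset.grade_eq (⟨s, hs⟩ : FacePoset Δ)
  dsimp only at this
  omega

/-- Dimension is injective on a chain, so the choice made in `topSimplex` is no choice at all. -/
theorem mem_kflag_iff {n : ℕ} (c : (coveringFamily Δ).kflags n) {s : Finset V}
    (hs : s ∈ Δ.faces) (hn : s.card = n + 1) :
    (⟨s, hs⟩ : FacePoset Δ) ∈ c.1 ↔ s = (topSimplex Δ n c).1 := by
  constructor
  · intro h
    exact congrArg Subtype.val (grade_injOn c.2.1.1 h (topSimplex_mem Δ n c)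
      ((grade_of_card Δ hs hn).trans (grade_of_card Δ _ (topSimplex Δ n c).2.2).symm))
  · rintro rfl
    exact topSimplex_mem Δ n c

theorem topSimplex_bijective (n : ℕ) : Function.Bijective (topSimplex Δ n) := by
  constructor
  · intro c d h
    refine Subtype.ext (kflag_unique Δ n _ (grade_of_card Δ _ (topSimplex Δ n c).2.2) _ c.2 _ d.2
      (topSimplex_mem Δ n c) ?_)
    rw [mem_kflag_iff Δ d _ (topSimplex Δ n c).2.2, h]
  · rintro ⟨s, hs, hn⟩
    obtain ⟨c, hc, hsc⟩ := exists_kflag Δ n ⟨s, hs⟩ (grade_of_card Δ hs hn)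
    exact ⟨⟨c, hc⟩, Subtype.ext ((mem_kflag_iff Δ ⟨c, hc⟩ hs hn).1 hsc).symm⟩

/-! ### The isomorphism of chain complexes -/

/-- Every simplex is the largest member of exactly one basis flag. -/
def chainsEquiv (n : ℕ) : simplicialChains Δ R n ≃ₗ[R] ((coveringFamily Δ).kflags n →₀ R) :=
  Finsupp.supportedEquivFinsupp _ ≪≫ₗ
    Finsupp.domLCongr (Equiv.ofBijective _ (topSimplex_bijective Δ n)).symm

theorem chainsEquiv_apply (n : ℕ) (z : simplicialChains Δ R n)
    (c : (coveringFamily Δ).kflags n) :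
    chainsEquiv Δ R n z c = (z : Finset V →₀ R) (topSimplex Δ n c) := by
  rfl

/-- The sign in `coord` and the equal sign in `subdivision_single_apply` multiply to `1`. Hence the
reindexing `chainsEquiv` is subdivision seen in coordinates, which lets it inherit the chain map
property. -/
theorem coord_subdivision (n : ℕ) (z : simplicialChains Δ R n) :
    (coveringFamily Δ).coordEquiv R n
      ⟨subdivision Δ R (n + 1) z, subdivision_mem_relCycles Δ R n z.2⟩ =
        chainsEquiv Δ R n z := by
  ext c
  rw [chainsEquiv_apply]
  change (-1 : R) ^ (n * (n + 1) / 2) * subdivision Δ R (n + 1) z c.1 = _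
  refine supported_induction R
    ((-1 : R) ^ (n * (n + 1) / 2) • (Finsupp.lapply c.1).comp (subdivision Δ R (n + 1)))
    (Finsupp.lapply (topSimplex Δ n c).1) (fun s hs => ?_) z.2
  have h := subdivision_single_apply Δ R n ⟨s, hs.1⟩ (grade_of_card Δ hs.1 hs.2) c c.2
  simp only [LinearMap.smul_apply, LinearMap.comp_apply, Finsupp.lapply_apply, smul_eq_mul]
  dsimp only at h
  rw [h, Finsupp.single_apply]
  simp only [mem_kflag_iff Δ c hs.1 hs.2]
  split_ifs
  · exact neg_one_pow_mul_self R _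
  · exact mul_zero _

theorem d_chainsEquiv (n : ℕ) (z : simplicialChains Δ R (n + 1)) :
    (coveringFamily Δ).d R n (chainsEquiv Δ R (n + 1) z) =
      chainsEquiv Δ R n ⟨boundary R z, boundary_mem_simplicialChains Δ R n z.2⟩ := by
  -- Once both sides are coordinates of subdivided chains, the inverse coordinates inside `d`
  -- cancel, and what is left is that subdivision commutes with the boundary.
  rw [← coord_subdivision, ← coord_subdivision]
  simp only [LocalCoveringFamily.d, LinearMap.comp_apply, LinearEquiv.coe_coe,
    LinearEquiv.symm_apply_apply]
  congr 1
  exact Subtype.ext (boundary_subdivision Δ R (n + 1) z.2)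

/-- The complex of the covering family of a simplicial complex is its simplicial chain complex. -/
def complexIso : simplicialChainComplex Δ R ≅ (coveringFamily Δ).complex R :=
  HomologicalComplex.Hom.isoOfComponents
    (fun n => (show ModuleCat.of R (simplicialChains Δ R n) ≅
      ModuleCat.of R ((coveringFamily Δ).kflags n →₀ R) from (chainsEquiv Δ R n).toModuleIso))
    (by
      -- Commutation is needed only from degree `n + 1` to degree `n`, where `ChainComplex.of_d`
      -- exposes both differentials.
      rintro _ n rfl
      simp only [simplicialChainComplex, LocalCoveringFamily.complex, ChainComplex.of_d]
      ext z : 2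
      exact d_chainsEquiv Δ R n z)

end LocalCovering

end

theorem theorem2 {V : Type*} [LinearOrder V] (Δ : PreAbstractSimplicialComplex V)
    (R : Type*) [CommRing R] :
    Nonempty ((LocalCovering.coveringFamily Δ).complex R ≅
      LocalCovering.simplicialChainComplex Δ R) :=
  ⟨(LocalCovering.complexIso Δ R).symm⟩
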